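/- Let $k$ be a commutative artinian ring, let $E$ be a minimal injective cogenerator of the category of $k$-modules, and put $D=\operatorname{Hom}_k(-,E)$. Let $n\ge 1$ and let $(\mathcal C,\mathbb E,\mathfrak s)$ be an $n$-exangulated category in the sense of Herschend–Liu–Nakaoka. Assume that it is - $k$-linear: all $\mathcal C(A,B)$ and $\mathbb E(A,B)$ are $k$-modules, and the composition of morphisms and the action $\mathcal C(A,B)\times\mathbb E(B,C)\times\mathcal C(C,D')\to\mathbb E(A,D')$ are $k$-linear in each variable; - Ext-finite: every $\mathbb E(A,B)$ is a finitely generated $k$-module; - Krull–Schmidt: every object is a finite direct sum of objects with local endomorphism rings. A morphism $f\colon X\to Y$ is called $n$-projectively trivial if $\mathbb E(f,Z)=0$ for all $Z$, and $n$-injectively trivial if $\mathbb E(Z,f)=0$ for all $Z$. An object is projective (injective) if its identity is $n$-projectively ($n$-injectively) trivial. Let $\underline{\mathcal C}(X,Y)$ and $\overline{\mathcal C}(X,Y)$ be the quotients of $\mathcal C(X,Y)$ by the $n$-projectively trivial and by the $n$-injectively trivial morphisms, respectively. A morphism $f\colon X\to Y$ is left almost split if it is not a split monomorphism and every $X\to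 Z$ that is not a split monomorphism factors through $f$; right almost split is the dual notion. A distinguished $n$-exangle $$X_0\xrightarrow{\alpha_0}X_1\xrightarrow{\alpha_1}\cdots\xrightarrow{\alpha_{n-1}}X_n\xrightarrow{\alpha_n}X_{n+1}\overset{\delta}{\dashrightarrow}$$ is called an Auslander–Reiten $n$-exangle if $\alpha_0$ is left almost split, $\alpha_n$ is right almost split, and $\alpha_1,\dots,\alpha_{n-1}$ lie in the Jacobson radical of $\mathcal C$ (no condition if $n=1$). **Lemma.** Let $X_0$ be an indecomposable non-injective object and $X_{n+1}$ an indecomposable non-projective object of $\mathcal C$. Then the following are equivalent. 1. There is an Auslander–Reiten $n$-exangle $X_0\to X_1\to\cdots\to X_n\to X_{n+1}\overset{\delta}{\dashrightarrow}$ with end terms $X_0$ and $X_{n+1}$. 2. There is an isomorphism $\underline{\mathcal C}(X_{n+1},-)\cong D\,\mathbb E(-,X_0)$ of functors from $\mathcal C$ to $k$-modules. 3. There is an isomorphism $\mathbb E(X_{n+1},-)\cong D\,\overline{\mathcal C}(-,X_0)$ of functors from $\mathcal C$ to $k$-modules. -/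

import Mathlib

open CategoryTheory CategoryTheory.Limits Opposite

open scoped ZeroObject

universe w v u uk

attribute [local instance] hasBinaryBiproducts_of_finite_biproducts

noncomputable section

/-! ### Additive categories -/

section Additive

variable {C : Type u} [Category.{v} C] [Preadditive C]

/-- The Jacobson radical of the category: `f : X ⟶ Y` lies in the radical if and only if `1 - gf`
is invertible in `End X` for every `g : Y ⟶ X`. -/
def InRadical {X Y : C} (f : X ⟶ Y) : Prop :=
  ∀ g : Y ⟶ X, IsIso (𝟙 X - f ≫ g)

/-- `f : X ⟶ Y` is left almost split: it is not a section, and every `g : X ⟶ Z` that is not a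
section factors through `f`. -/
def IsLeftAlmostSplit {X Y : C} (f : X ⟶ Y) : Prop :=
  ¬ IsSplitMono f ∧ ∀ ⦃Z : C⦄ (g : X ⟶ Z), ¬ IsSplitMono g → ∃ h : Y ⟶ Z, f ≫ h = g

/-- `f : X ⟶ Y` is right almost split: it is not a retraction, and every `g : Z ⟶ Y` that is not a
retraction factors through `f`. -/
def IsRightAlmostSplit {X Y : C} (f : X ⟶ Y) : Prop :=
  ¬ IsSplitEpi f ∧ ∀ ⦃Z : C⦄ (g : Z ⟶ Y), ¬ IsSplitEpi g → ∃ h : Z ⟶ X, h ≫ f = g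

variable (C) in
/-- Every object is a finite direct sum of objects with local endomorphism rings. -/
def IsKrullSchmidt [HasFiniteBiproducts C] : Prop :=
  ∀ X : C, ∃ (m : ℕ) (Y : Fin m → C),
    (∀ i, IsLocalRing (End (Y i))) ∧ Nonempty (X ≅ ⨁ Y)

end Additive

/-! ### Complexes `A = X₀ ⟶ X₁ ⟶ ⋯ ⟶ Xₙ ⟶ Xₙ₊₁ = B` -/

section Complexes

variable {C : Type u} [Category.{v} C] [Preadditive C]

/-- A complex concentrated in degrees `0, …, n + 1`, whose end terms are identified with the
objects `A` (in degree `0`) and `B` (in degree `n + 1`). -/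
structure NComplex (n : ℕ) (A B : C) where
  cx : CochainComplex C ℕ
  isZero : ∀ i, n + 1 < i → IsZero (cx.X i)
  left : cx.X 0 ≅ A
  right : cx.X (n + 1) ≅ B

namespace NComplex

variable {n : ℕ}

/-- The first differential `A ⟶ X₁`. -/
def first {A B : C} (X : NComplex n A B) : A ⟶ X.cx.X 1 :=
  X.left.inv ≫ X.cx.d 0 1

/-- The last differential `Xₙ ⟶ B`. -/
def last {A B : C} (X : NComplex n A B) : X.cx.X n ⟶ B :=
  X.cx.d n (n + 1) ≫ X.right.hom

/-- The chain map `f` has the components `a` in degree `0` and `b` in degree `n + 1`. -/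
def HasEnds {A B A' B' : C} (X : NComplex n A B) (Y : NComplex n A' B') (f : X.cx ⟶ Y.cx)
    (a : A ⟶ A') (b : B ⟶ B') : Prop :=
  f.f 0 ≫ Y.left.hom = X.left.hom ≫ a ∧ f.f (n + 1) ≫ Y.right.hom = X.right.hom ≫ b

/-- Homotopy equivalence of complexes with the same end terms `A` and `B`: there are chain maps
in both directions that are the identity on `A` and on `B`, and both of whose composites are
homotopic to the identity. -/
def HomotopyEquivalent {A B : C} (X Y : NComplex n A B) : Prop :=
  ∃ e : HomotopyEquiv X.cx Y.cx,
    HasEnds X Y e.hom (𝟙 A) (𝟙 B) ∧ HasEnds Y X e.inv (𝟙 A) (𝟙 B)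

theorem HasEnds.comp {A B : C} {X Y Z : NComplex n A B} {f : X.cx ⟶ Y.cx} {g : Y.cx ⟶ Z.cx}
    (hf : HasEnds X Y f (𝟙 A) (𝟙 B)) (hg : HasEnds Y Z g (𝟙 A) (𝟙 B)) :
    HasEnds X Z (f ≫ g) (𝟙 A) (𝟙 B) := by
  obtain ⟨h1, h2⟩ := hf
  obtain ⟨h3, h4⟩ := hg
  simp only [Category.comp_id] at h1 h2 h3 h4
  constructor <;> simp [h1, h2, h3, h4]

theorem homotopyEquivalent_equivalence (n : ℕ) (A B : C) :
    Equivalence (HomotopyEquivalent (n := n) (A := A) (B := B)) where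
  refl X := ⟨HomotopyEquiv.refl _, by simp [HasEnds], by simp [HasEnds]⟩
  symm := fun ⟨e, h1, h2⟩ => ⟨e.symm, h2, h1⟩
  trans := fun ⟨e, h1, h2⟩ ⟨e', h1', h2'⟩ => ⟨e.trans e', h1.comp h1', h2'.comp h2⟩

/-- The setoid whose classes are the homotopy equivalence classes `[X]`. -/
instance setoid (n : ℕ) (A B : C) : Setoid (NComplex n A B) :=
  ⟨HomotopyEquivalent, homotopyEquivalent_equivalence n A B⟩

/-- The complex `A = A ⟶ 0 ⟶ ⋯ ⟶ 0`, with end terms `A` and `0`. -/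
def trivialLeft [HasFiniteBiproducts C] {n : ℕ} (hn : 1 ≤ n) (A : C) :
    NComplex n A (0 : C) where
  cx := HomologicalComplex.double (𝟙 A) (c := ComplexShape.up ℕ) (i₀ := 0) (i₁ := 1) rfl
  isZero i hi := HomologicalComplex.isZero_double_X _ _ _ (by omega) (by omega)
  left := HomologicalComplex.doubleXIso₀ _ _
  right := (HomologicalComplex.isZero_double_X _ _ _ (by omega) (by omega)).iso (isZero_zero C)

/-- The complex `0 ⟶ ⋯ ⟶ 0 ⟶ B = B`, with end terms `0` and `B`. -/
def trivialRight [HasFiniteBiproducts C] {n : ℕ} (hn : 1 ≤ n) (B : C) :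
    NComplex n (0 : C) B where
  cx := HomologicalComplex.double (𝟙 B) (c := ComplexShape.up ℕ) (i₀ := n) (i₁ := n + 1) rfl
  isZero i hi := HomologicalComplex.isZero_double_X _ _ _ (by omega) (by omega)
  left := (HomologicalComplex.isZero_double_X _ _ _ (by omega) (by omega)).iso (isZero_zero C)
  right := HomologicalComplex.doubleXIso₁ _ _ (by omega)

/-- `M` is the mapping cone
`X₁ ⟶ X₂ ⊞ Y₁ ⟶ X₃ ⊞ Y₂ ⟶ ⋯ ⟶ Xₙ₊₁ ⊞ Yₙ ⟶ Yₙ₊₁`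
of the chain map `f : X ⟶ Y` (used when `f` is the identity in degree `0`). The differentials are
`(-d, f)` at the start, `(x, y) ↦ (-d x, f x + d y)` in the middle, and `(x, y) ↦ f x + d y` at the
end. -/
def IsMappingCone [HasFiniteBiproducts C] {A A' B B' : C} (X : NComplex n A B)
    (Y : NComplex n A' B') (f : X.cx ⟶ Y.cx) (M : NComplex n (X.cx.X 1) B') : Prop :=
  ∃ e : ∀ i, 1 ≤ i → i ≤ n → (M.cx.X i ≅ X.cx.X (i + 1) ⊞ Y.cx.X i),
    (∀ h : 1 ≤ n,
      M.first ≫ (e 1 le_rfl h).hom = biprod.lift (-(X.cx.d 1 2)) (f.f 1)) ∧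
    (∀ (i : ℕ) (h1 : 1 ≤ i) (h2 : i + 1 ≤ n),
      M.cx.d i (i + 1) ≫ (e (i + 1) (by omega) h2).hom =
        (e i h1 (by omega)).hom ≫
          biprod.lift (biprod.fst ≫ (-(X.cx.d (i + 1) (i + 2))))
            (biprod.fst ≫ f.f (i + 1) + biprod.snd ≫ Y.cx.d i (i + 1))) ∧
    (∀ h : 1 ≤ n,
      M.last = (e n h le_rfl).hom ≫ biprod.desc (f.f (n + 1) ≫ Y.right.hom) Y.last)

/-- `N` is the mapping cocone
`X₀ ⟶ Y₀ ⊞ X₁ ⟶ Y₁ ⊞ X₂ ⟶ ⋯ ⟶ Yₙ₋₁ ⊞ Xₙ ⟶ Yₙ`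
of the chain map `f : X ⟶ Y` (used when `f` is the identity in degree `n + 1`): the dual of the
mapping cone. The differentials are `(f, d)` at the start, `(y, x) ↦ (-d y + f x, d x)` in the
middle, and `(y, x) ↦ -d y + f x` at the end. The index `i` of `Yᵢ₋₁ ⊞ Xᵢ` is positive. -/
def IsMappingCocone [HasFiniteBiproducts C] {A A' B B' : C} (X : NComplex n A B)
    (Y : NComplex n A' B') (f : X.cx ⟶ Y.cx) (N : NComplex n A (Y.cx.X n)) : Prop :=
  ∃ e : ∀ i, 1 ≤ i → i ≤ n → (N.cx.X i ≅ Y.cx.X (i - 1) ⊞ X.cx.X i),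
    (∀ h : 1 ≤ n,
      N.first ≫ (e 1 le_rfl h).hom = biprod.lift (X.left.inv ≫ f.f 0) X.first) ∧
    (∀ (i : ℕ) (h1 : 1 ≤ i) (h2 : i + 1 ≤ n),
      N.cx.d i (i + 1) ≫ (e (i + 1) (by omega) h2).hom =
        (e i h1 (by omega)).hom ≫
          biprod.lift (biprod.fst ≫ (-(Y.cx.d (i - 1) i)) + biprod.snd ≫ f.f i)
            (biprod.snd ≫ X.cx.d i (i + 1))) ∧
    (∀ h : 1 ≤ n,
      N.last = (e n h le_rfl).hom ≫ biprod.desc (-(Y.cx.d (n - 1) n)) (f.f n))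

end NComplex

end Complexes

/-! ### Bilinear bifunctors and extensions -/

section Extensions

variable {k : Type uk} [CommRing k] {C : Type u} [Category.{v} C]

/-- The module `𝔼(B, A)` of extensions. -/
abbrev Extn (𝔼 : Cᵒᵖ ⥤ C ⥤ ModuleCat.{w} k) (B A : C) : Type w :=
  (𝔼.obj (op B)).obj A

/-- `a_* δ`. -/
def pushExt (𝔼 : Cᵒᵖ ⥤ C ⥤ ModuleCat.{w} k) {A A' B : C} (a : A ⟶ A') :
    Extn 𝔼 B A →ₗ[k] Extn 𝔼 B A' :=
  ((𝔼.obj (op B)).map a).hom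

/-- `b^* δ`. -/
def pullExt (𝔼 : Cᵒᵖ ⥤ C ⥤ ModuleCat.{w} k) {A B B' : C} (b : B' ⟶ B) :
    Extn 𝔼 B A →ₗ[k] Extn 𝔼 B' A :=
  ((𝔼.map b.op).app A).hom

/-- The bifunctor `𝔼` is `k`-linear (in particular additive) in both variables, so that the
action `𝒞(A, B) × 𝔼(B, C) × 𝒞(C, D) → 𝔼(A, D)` is `k`-trilinear. -/
class IsBilinearBifunctor [Preadditive C] [Linear k C] (𝔼 : Cᵒᵖ ⥤ C ⥤ ModuleCat.{w} k) :
    Prop where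
  push_add : ∀ {A A' B : C} (a a' : A ⟶ A') (δ : Extn 𝔼 B A),
    pushExt 𝔼 (a + a') δ = pushExt 𝔼 a δ + pushExt 𝔼 a' δ
  push_smul : ∀ {A A' B : C} (r : k) (a : A ⟶ A') (δ : Extn 𝔼 B A),
    pushExt 𝔼 (r • a) δ = r • pushExt 𝔼 a δ
  pull_add : ∀ {A B B' : C} (b b' : B' ⟶ B) (δ : Extn 𝔼 B A),
    pullExt 𝔼 (b + b') δ = pullExt 𝔼 b δ + pullExt 𝔼 b' δ
  pull_smul : ∀ {A B B' : C} (r : k) (b : B' ⟶ B) (δ : Extn 𝔼 B A),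
    pullExt 𝔼 (r • b) δ = r • pullExt 𝔼 b δ

/-- `f` is `n`-projectively trivial: `𝔼(f, Z) = 0` for all `Z`. -/
def IsProjTrivial (𝔼 : Cᵒᵖ ⥤ C ⥤ ModuleCat.{w} k) {X Y : C} (f : X ⟶ Y) : Prop :=
  ∀ (Z : C) (δ : Extn 𝔼 Y Z), pullExt 𝔼 f δ = 0

/-- `g` is `n`-injectively trivial: `𝔼(Z, g) = 0` for all `Z`. -/
def IsInjTrivial (𝔼 : Cᵒᵖ ⥤ C ⥤ ModuleCat.{w} k) {X Y : C} (g : X ⟶ Y) : Prop :=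
  ∀ (Z : C) (δ : Extn 𝔼 Z X), pushExt 𝔼 g δ = 0

/-- Projective objects with respect to `𝔼`. -/
def IsProjectiveObj (𝔼 : Cᵒᵖ ⥤ C ⥤ ModuleCat.{w} k) (X : C) : Prop :=
  IsProjTrivial 𝔼 (𝟙 X)

/-- Injective objects with respect to `𝔼`. -/
def IsInjectiveObj (𝔼 : Cᵒᵖ ⥤ C ⥤ ModuleCat.{w} k) (X : C) : Prop :=
  IsInjTrivial 𝔼 (𝟙 X)

theorem pushExt_comp_apply (𝔼 : Cᵒᵖ ⥤ C ⥤ ModuleCat.{w} k) {A A' A'' B : C} (a : A ⟶ A')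
    (a' : A' ⟶ A'') (δ : Extn 𝔼 B A) :
    pushExt 𝔼 (a ≫ a') δ = pushExt 𝔼 a' (pushExt 𝔼 a δ) := by
  simp [pushExt]

theorem pullExt_comp_apply (𝔼 : Cᵒᵖ ⥤ C ⥤ ModuleCat.{w} k) {A B B' B'' : C} (b' : B'' ⟶ B')
    (b : B' ⟶ B) (δ : Extn 𝔼 B A) :
    pullExt 𝔼 (b' ≫ b) δ = pullExt 𝔼 b' (pullExt 𝔼 b δ) := by
  simp [pullExt]

end Extensions

/-! ### `n`-exangulated categories -/

section Exangulated

variable {k : Type uk} [CommRing k] {C : Type u} [Category.{v} C] [Preadditive C]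
  {n : ℕ}

/-- `⟨X, δ⟩` is an `n`-exangle: both `(d₀)_* δ` and `(dₙ)^* δ` vanish, and the sequences
`𝒞(-, X₀) ⟶ ⋯ ⟶ 𝒞(-, Xₙ₊₁) ⟶ 𝔼(-, X₀)` and `𝒞(Xₙ₊₁, -) ⟶ ⋯ ⟶ 𝒞(X₀, -) ⟶ 𝔼(Xₙ₊₁, -)`
are exact. -/
structure IsNExangle (𝔼 : Cᵒᵖ ⥤ C ⥤ ModuleCat.{w} k) {A B : C} (X : NComplex n A B)
    (δ : Extn 𝔼 B A) : Prop where
  push_first : pushExt 𝔼 X.first δ = 0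
  pull_last : pullExt 𝔼 X.last δ = 0
  exact_to : ∀ (i : ℕ), i < n → ∀ (W : C) (f : W ⟶ X.cx.X (i + 1)),
    f ≫ X.cx.d (i + 1) (i + 2) = 0 → ∃ g : W ⟶ X.cx.X i, g ≫ X.cx.d i (i + 1) = f
  exact_to_end : ∀ (W : C) (f : W ⟶ B), pullExt 𝔼 f δ = 0 →
    ∃ g : W ⟶ X.cx.X n, g ≫ X.last = f
  exact_from : ∀ (i : ℕ), i < n → ∀ (W : C) (f : X.cx.X (i + 1) ⟶ W),
    X.cx.d i (i + 1) ≫ f = 0 → ∃ g : X.cx.X (i + 2) ⟶ W, X.cx.d (i + 1) (i + 2) ≫ g = f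
  exact_from_end : ∀ (W : C) (f : A ⟶ W), pushExt 𝔼 f δ = 0 →
    ∃ g : X.cx.X 1 ⟶ W, X.first ≫ g = f

/-- A correspondence that assigns to each extension `δ ∈ 𝔼(B, A)` a homotopy equivalence class
of complexes with end terms `A` and `B`. -/
def ExtnRealization (𝔼 : Cᵒᵖ ⥤ C ⥤ ModuleCat.{w} k) (n : ℕ) : Type (max u v w) :=
  ∀ (A B : C), Extn 𝔼 B A → Quotient (NComplex.setoid n A B)

/-- `X` realizes `δ`, that is, `𝔰(δ) = [X]`. -/
def ExtnRealization.Realizes {𝔼 : Cᵒᵖ ⥤ C ⥤ ModuleCat.{w} k} (s : ExtnRealization 𝔼 n) {A B : C}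
    (X : NComplex n A B) (δ : Extn 𝔼 B A) : Prop :=
  s A B δ = Quotient.mk _ X

/-- `s` is an exact realization of `𝔼`. -/
structure IsExactRealization [HasFiniteBiproducts C] (hn : 1 ≤ n)
    (𝔼 : Cᵒᵖ ⥤ C ⥤ ModuleCat.{w} k) (s : ExtnRealization 𝔼 n) : Prop where
  /-- Morphisms of extensions lift to morphisms of complexes. -/
  lift : ∀ {A B A' B' : C} (δ : Extn 𝔼 B A) (ρ : Extn 𝔼 B' A') (X : NComplex n A B)
    (Y : NComplex n A' B'), s.Realizes X δ → s.Realizes Y ρ →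
    ∀ (a : A ⟶ A') (b : B ⟶ B'), pushExt 𝔼 a δ = pullExt 𝔼 b ρ →
      ∃ f : X.cx ⟶ Y.cx, NComplex.HasEnds X Y f a b
  exangle : ∀ {A B : C} (δ : Extn 𝔼 B A) (X : NComplex n A B),
    s.Realizes X δ → IsNExangle 𝔼 X δ
  trivial_left : ∀ A : C, s.Realizes (NComplex.trivialLeft hn A) (0 : Extn 𝔼 (0 : C) A)
  trivial_right : ∀ B : C, s.Realizes (NComplex.trivialRight hn B) (0 : Extn 𝔼 B (0 : C))

/-- `f` is an inflation: it is the first differential of a conflation. -/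
def ExtnRealization.IsInflation {𝔼 : Cᵒᵖ ⥤ C ⥤ ModuleCat.{w} k} (s : ExtnRealization 𝔼 n)
    {A A' : C} (f : A ⟶ A') : Prop :=
  ∃ (B : C) (δ : Extn 𝔼 B A) (X : NComplex n A B) (e : X.cx.X 1 ≅ A'),
    s.Realizes X δ ∧ X.first ≫ e.hom = f

/-- `g` is a deflation: it is the last differential of a conflation. -/
def ExtnRealization.IsDeflation {𝔼 : Cᵒᵖ ⥤ C ⥤ ModuleCat.{w} k} (s : ExtnRealization 𝔼 n)
    {B' B : C} (g : B' ⟶ B) : Prop :=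
  ∃ (A : C) (δ : Extn 𝔼 B A) (X : NComplex n A B) (e : B' ≅ X.cx.X n),
    s.Realizes X δ ∧ e.hom ≫ X.last = g

/-- `(𝒞, 𝔼, 𝔰)` is an `n`-exangulated category (for `𝔼` an additive bifunctor). -/
structure IsNExangulated [HasFiniteBiproducts C] (hn : 1 ≤ n)
    (𝔼 : Cᵒᵖ ⥤ C ⥤ ModuleCat.{w} k) (s : ExtnRealization 𝔼 n) : Prop
    extends IsExactRealization hn 𝔼 s where
  inflation_comp : ∀ {X Y Z : C} (f : X ⟶ Y) (g : Y ⟶ Z),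
    s.IsInflation f → s.IsInflation g → s.IsInflation (f ≫ g)
  deflation_comp : ∀ {X Y Z : C} (f : X ⟶ Y) (g : Y ⟶ Z),
    s.IsDeflation f → s.IsDeflation g → s.IsDeflation (f ≫ g)
  /-- Good lifts of `(1, c)`: the mapping cone realizes `(d₀)_* ρ`. -/
  good_lift : ∀ {A B D : C} (ρ : Extn 𝔼 D A) (c : B ⟶ D) (X : NComplex n A B)
    (Y : NComplex n A D), s.Realizes X (pullExt 𝔼 c ρ) → s.Realizes Y ρ →
    ∃ (f : X.cx ⟶ Y.cx) (M : NComplex n (X.cx.X 1) D),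
      NComplex.HasEnds X Y f (𝟙 A) c ∧ NComplex.IsMappingCone X Y f M ∧
        s.Realizes M (pushExt 𝔼 X.first ρ)
  /-- Good lifts of `(a, 1)`: the mapping cocone realizes `(dₙ)^* ρ`. -/
  good_lift_op : ∀ {A A' B : C} (ρ : Extn 𝔼 B A) (a : A ⟶ A') (X : NComplex n A B)
    (Y : NComplex n A' B), s.Realizes X ρ → s.Realizes Y (pushExt 𝔼 a ρ) →
    ∃ (f : X.cx ⟶ Y.cx) (N : NComplex n A (Y.cx.X n)),
      NComplex.HasEnds X Y f a (𝟙 B) ∧ NComplex.IsMappingCocone X Y f N ∧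
        s.Realizes N (pullExt 𝔼 Y.last ρ)

/-- The distinguished `n`-exangle `⟨X, δ⟩` is an Auslander–Reiten `n`-exangle. -/
structure IsAuslanderReiten {𝔼 : Cᵒᵖ ⥤ C ⥤ ModuleCat.{w} k} (s : ExtnRealization 𝔼 n) {A B : C}
    (X : NComplex n A B) (δ : Extn 𝔼 B A) : Prop where
  realizes : s.Realizes X δ
  left_almost_split : IsLeftAlmostSplit X.first
  right_almost_split : IsRightAlmostSplit X.last
  radical : ∀ i, 1 ≤ i → i < n → InRadical (X.cx.d i (i + 1))

end Exangulated

/-! ### Stable categories and duality -/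

section Duality

variable {k : Type uk} [CommRing k] {C : Type u} [Category.{v} C] [Preadditive C] [Linear k C]
  (𝔼 : Cᵒᵖ ⥤ C ⥤ ModuleCat.{w} k) [IsBilinearBifunctor 𝔼]

/-- The submodule `𝒫(X, Y)` of `n`-projectively trivial morphisms. -/
def projTrivial (X Y : C) : Submodule k (X ⟶ Y) where
  carrier := {f | IsProjTrivial 𝔼 f}
  add_mem' := by
    intro f g hf hg Z δ
    rw [IsBilinearBifunctor.pull_add, hf, hg, add_zero]
  zero_mem' := by
    intro Z δ
    have h := IsBilinearBifunctor.pull_smul (𝔼 := 𝔼) (0 : k) (0 : X ⟶ Y) δ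
    simpa using h
  smul_mem' := by
    intro r f hf Z δ
    rw [IsBilinearBifunctor.pull_smul, hf, smul_zero]

/-- The submodule `ℐ(X, Y)` of `n`-injectively trivial morphisms. -/
def injTrivial (X Y : C) : Submodule k (X ⟶ Y) where
  carrier := {f | IsInjTrivial 𝔼 f}
  add_mem' := by
    intro f g hf hg Z δ
    rw [IsBilinearBifunctor.push_add, hf, hg, add_zero]
  zero_mem' := by
    intro Z δ
    have h := IsBilinearBifunctor.push_smul (𝔼 := 𝔼) (0 : k) (0 : X ⟶ Y) δ
    simpa using h
  smul_mem' := by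
    intro r f hf Z δ
    rw [IsBilinearBifunctor.push_smul, hf, smul_zero]

/-- Morphisms in the stable category: `𝒞(X, Y) / 𝒫(X, Y)`. -/
abbrev StableHom (X Y : C) : Type v := (X ⟶ Y) ⧸ projTrivial 𝔼 X Y

/-- Morphisms in the costable category: `𝒞(X, Y) / ℐ(X, Y)`. -/
abbrev CostableHom (X Y : C) : Type v := (X ⟶ Y) ⧸ injTrivial 𝔼 X Y

/-- The functor `𝒞(X, -)` modulo `𝒫`, on morphisms: postcomposition with `g`. -/
def stablePost (X : C) {Y Z : C} (g : Y ⟶ Z) : StableHom 𝔼 X Y →ₗ[k] StableHom 𝔼 X Z :=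
  Submodule.mapQ _ _ (Linear.rightComp k X g) (by
    intro f hf W δ
    change pullExt 𝔼 (f ≫ g) δ = 0
    rw [pullExt_comp_apply]
    exact hf W _)

/-- The functor `𝒞(-, Z)` modulo `ℐ`, on morphisms: precomposition with `g`. -/
def costablePre {X Y : C} (g : X ⟶ Y) (Z : C) : CostableHom 𝔼 Y Z →ₗ[k] CostableHom 𝔼 X Z :=
  Submodule.mapQ _ _ (Linear.leftComp k Z g) (by
    intro f hf W δ
    change pushExt 𝔼 (g ≫ f) δ = 0
    rw [pushExt_comp_apply]
    exact hf W _)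

variable (J : Type uk) [AddCommGroup J] [Module k J]

/-- There is an isomorphism of functors from `𝒞` to `k`-modules between the stable Hom functor
`X ↦ 𝒞(B, X) / 𝒫(B, X)` and `X ↦ D 𝔼(X, A)`, where `D = Hom_k(-, J)`. -/
def StableHomIsoDualExt (B A : C) : Prop :=
  ∃ φ : ∀ X : C, StableHom 𝔼 B X ≃ₗ[k] (Extn 𝔼 X A →ₗ[k] J),
    ∀ (X Y : C) (g : X ⟶ Y) (b : StableHom 𝔼 B X),
      φ Y (stablePost 𝔼 B g b) = φ X b ∘ₗ pullExt 𝔼 g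

/-- There is an isomorphism of functors from `𝒞` to `k`-modules between `X ↦ 𝔼(B, X)` and
`X ↦ D (𝒞(X, A) / ℐ(X, A))`, where `D = Hom_k(-, J)`. -/
def ExtIsoDualCostableHom (B A : C) : Prop :=
  ∃ φ : ∀ X : C, Extn 𝔼 B X ≃ₗ[k] (CostableHom 𝔼 X A →ₗ[k] J),
    ∀ (X Y : C) (g : X ⟶ Y) (δ : Extn 𝔼 B X),
      φ Y (pushExt 𝔼 g δ) = φ X δ ∘ₗ costablePre 𝔼 g A

end Duality

section Cogenerator

variable (k : Type uk) [CommRing k] (J : Type uk) [AddCommGroup J] [Module k J]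

/-- `J` is an injective cogenerator for `k`-modules. -/
structure IsInjectiveCogenerator : Prop where
  injective : Module.Injective k J
  cogenerates : ∀ (M : Type uk) [AddCommGroup M] [Module k M] (m : M), m ≠ 0 →
    ∃ f : M →ₗ[k] J, f m ≠ 0

/-- `J` is a minimal injective cogenerator: no proper submodule is an injective cogenerator. -/
structure IsMinimalInjectiveCogenerator : Prop extends IsInjectiveCogenerator k J where
  minimal : ∀ N : Submodule k J, IsInjectiveCogenerator k N → N = ⊤

end Cogenerator

end

/-! Write `A` and `B` for the left and right end terms. Everything is governed by a nonzero
extension `δ ∈ 𝔼(B, A)` that is killed by pushing along nonsections out of `A` and by pulling along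
nonretractions into `B`.

From an Auslander–Reiten `n`-exangle one gets such a `δ` with a socle property: every nonzero `ζ ∈
𝔼(B, Z)` can be pushed to `δ`, and every nonzero `θ ∈ 𝔼(F, A)` can be pulled to `δ`. Choose `γ :
𝔼(B, A) → J` with `γ δ ≠ 0`. The pairings `(f, ε) ↦ γ (f^* ε)` and `(f, ζ) ↦ γ (f_* ζ)` are then
nondegenerate on both sides once trivial morphisms are factored out. Dualizing into a minimal
injective cogenerator does not increase length, so these pairings are perfect
(`bijective_of_nondegenerate`), which gives both dualities.

Conversely, either duality forces `𝔼(B, A) ≠ 0`, because `B` is not projective or `A` is not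
injective. Choose `δ` generating a minimal nonzero orbit module under `End B` (or `End A`). The
duality shows that `g^* δ ≠ 0` implies `(f ≫ g)^* δ ≠ 0` for some `f`. Minimality brings this
element back to `δ`, and since `End B` is local, `g` is a retraction. The long exact sequences of
`𝔼` (`exists_pushExt_eq`, `exists_pullExt_eq`) carry the annihilation property to the other end.
Finally a complex realizing `δ` is made radical in the middle by splitting off contractible
summands. -/

noncomputable section

/-! ### Minimal injective cogenerators and perfect pairings. -/

section Matlis

variable {k : Type uk} [CommRing k]

theorem Submodule.exists_le_maximal_disjoint {M : Type*} [AddCommGroup M] [Module k M]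
    (P K : Submodule k M) (h : Disjoint P K) :
    ∃ N, P ≤ N ∧ Maximal (fun N => Disjoint N K) N := by
  refine zorn_le_nonempty₀ {N : Submodule k M | Disjoint N K} ?_ P h
  intro c hc hchain y hy
  refine ⟨sSup c, ?_, fun z hz => le_sSup hz⟩
  rw [Set.mem_ofPred_eq, Submodule.disjoint_def]
  intro x hx hxK
  obtain ⟨N, hN, hxN⟩ := (Submodule.mem_sSup_of_directed ⟨y, hy⟩ hchain.directedOn).1 hx
  exact Submodule.disjoint_def.1 (hc hN) x hxN hxK

/-- If `N` is maximal among the submodules disjoint from `K` and `v ∉ N`, then `N + k v` contains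
a nonzero element of `K`. -/
theorem Submodule.exists_mem_of_maximal_disjoint {M : Type*} [AddCommGroup M] [Module k M]
    {N K : Submodule k M} (h : Maximal (fun N => Disjoint N K) N) {v : M} (hv : v ∉ N) :
    ∃ x ∈ N, ∃ r : k, x + r • v ≠ 0 ∧ x + r • v ∈ K := by
  by_contra! hcon
  apply hv
  have hd : Disjoint (N ⊔ Submodule.span k {v}) K := by
    rw [Submodule.disjoint_def]
    intro z hz hzK
    obtain ⟨x, hx, y, hy, rfl⟩ := Submodule.mem_sup.1 hz
    obtain ⟨r, rfl⟩ := Submodule.mem_span_singleton.1 hy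
    by_contra hne
    exact hcon x hx r hne hzK
  exact h.le_of_ge hd le_sup_left
    (Submodule.mem_sup_right (Submodule.mem_span_singleton_self v))

theorem eq_zero_of_smul_eq_zero_of_notMem {M : Type*} [AddCommGroup M] [Module k M]
    {m : Ideal k} (hm : m.IsMaximal) {z : M} (hz : ∀ a ∈ m, a • z = 0) {b : k} (hb : b ∉ m)
    (h : b • z = 0) : z = 0 := by
  obtain ⟨y, i, hi, hyi⟩ := hm.exists_inv hb
  rw [← one_smul k z, ← hyi, add_smul, mul_smul, h, hz i hi, smul_zero, add_zero]

/-- A complement submodule of an injective module is a direct summand. -/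
theorem Module.Baer.exists_retraction {J : Type*} [AddCommGroup J] [Module k J]
    (hJ : Module.Baer k J) {N K : Submodule k J} (hN : Maximal (fun N => Disjoint N K) N) :
    ∃ p : J →ₗ[k] N, ∀ x : N, p x = x := by
  obtain ⟨L, -, hL⟩ := Submodule.exists_le_maximal_disjoint ⊥ N disjoint_bot_left
  have hinj : Function.Injective (L.mkQ ∘ₗ N.subtype) := by
    rw [← LinearMap.ker_eq_bot, LinearMap.ker_eq_bot']
    intro x hx
    have hxL : (x : J) ∈ L := by simpa using hx
    exact Subtype.ext (Submodule.disjoint_def.1 hL.prop x hxL x.2)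
  obtain ⟨h, hh⟩ := hJ.extension_property _ hinj N.subtype
  have hp : ∀ x ∈ N, h (L.mkQ x) = x := fun x hx => LinearMap.congr_fun hh ⟨x, hx⟩
  have hle : N ≤ LinearMap.range (h ∘ₗ L.mkQ) := fun x hx => ⟨x, hp x hx⟩
  -- If `h v ∈ K` with `v ∉ L`, some `x + r • v` with `x ∈ L` is a nonzero element of `N`. It is
  -- fixed by `h`, so it equals `r • h v ∈ K`, against `N ∩ K = 0`. Maximality of `N` then
  -- identifies the range with `N`.
  have hdisj : Disjoint (LinearMap.range (h ∘ₗ L.mkQ)) K := by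
    rw [Submodule.disjoint_def]
    rintro _ ⟨v, rfl⟩ hK
    by_cases hv : v ∈ L
    · have : L.mkQ v = 0 := by simpa using hv
      simp [this]
    · exfalso
      obtain ⟨x, hx, r, hne, hmem⟩ := Submodule.exists_mem_of_maximal_disjoint hL hv
      have h1 := hp _ hmem
      have hx0 : L.mkQ x = 0 := by simpa using hx
      rw [map_add, hx0, zero_add, map_smul, map_smul] at h1
      refine hne (Submodule.disjoint_def.1 hN.prop _ hmem ?_)
      rw [← h1]
      exact K.smul_mem r hK
  have hrange := hN.le_of_ge hdisj hle
  refine ⟨LinearMap.codRestrict N (h ∘ₗ L.mkQ) fun x => hrange ⟨x, rfl⟩, fun x => ?_⟩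
  exact Subtype.ext (hp x x.2)

/-- Functionals with values in an injective module that contains all simple modules separate the
elements of every module. -/
theorem Module.Baer.exists_apply_ne_zero {J : Type*} [AddCommGroup J] [Module k J]
    (hJ : Module.Baer k J)
    (hsimple : ∀ m : Ideal k, m.IsMaximal → ∃ z : J, z ≠ 0 ∧ ∀ a ∈ m, a • z = 0)
    {M : Type*} [AddCommGroup M] [Module k M] {x : M} (hx : x ≠ 0) :
    ∃ f : M →ₗ[k] J, f x ≠ 0 := by
  set i := LinearMap.toSpanSingleton k M x
  have hi : LinearMap.ker i ≠ ⊤ := by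
    intro h
    have : (1 : k) ∈ LinearMap.ker i := h ▸ Submodule.mem_top
    exact hx (by simpa [i] using this)
  obtain ⟨m, hm, him⟩ := Ideal.exists_le_maximal (LinearMap.ker i) hi
  obtain ⟨z, hz0, hz⟩ := hsimple m hm
  -- The cyclic module `k x ≅ k / ker i` maps onto `k / m ≅ k z`; the Baer property extends this map
  -- to `M`. No universe constraint on `M` is needed.
  obtain ⟨f, hf⟩ := hJ.extension_property ((LinearMap.ker i).liftQ i le_rfl)
    (LinearMap.ker_eq_bot.1 (Submodule.ker_liftQ_eq_bot _ _ _ le_rfl))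
    ((LinearMap.ker i).liftQ (LinearMap.toSpanSingleton k J z) fun a ha => by
      simpa using hz a (him ha))
  refine ⟨f, ?_⟩
  have h1 := LinearMap.congr_fun hf ((LinearMap.ker i).mkQ 1)
  simp only [LinearMap.comp_apply, Submodule.mkQ_apply, Submodule.liftQ_apply] at h1
  simp only [i, LinearMap.toSpanSingleton_apply, one_smul] at h1
  rwa [h1]

variable {J : Type uk} [AddCommGroup J] [Module k J]

theorem IsInjectiveCogenerator.baer (hJ : IsInjectiveCogenerator k J) : Module.Baer k J :=
  Module.Baer.of_injective hJ.injective

theorem IsInjectiveCogenerator.exists_simple (hJ : IsInjectiveCogenerator k J) (m : Ideal k)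
    (hm : m.IsMaximal) : ∃ z : J, z ≠ 0 ∧ ∀ a ∈ m, a • z = 0 := by
  have h1 : (Ideal.Quotient.mk m 1) ≠ 0 := by
    rw [Ne, Ideal.Quotient.eq_zero_iff_mem]
    exact fun h => hm.ne_top ((Ideal.eq_top_iff_one m).2 h)
  obtain ⟨f, hf⟩ := hJ.cogenerates (k ⧸ m) _ h1
  refine ⟨_, hf, fun a ha => ?_⟩
  rw [← map_smul]
  have : a • (Ideal.Quotient.mk m 1) = 0 := by
    rw [← Ideal.Quotient.mk_eq_mk, ← Submodule.Quotient.mk_smul, smul_eq_mul, mul_one]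
    exact Ideal.Quotient.eq_zero_iff_mem.2 ha
  rw [this, map_zero]

theorem IsInjectiveCogenerator.exists_apply_ne_zero (hJ : IsInjectiveCogenerator k J)
    {M : Type*} [AddCommGroup M] [Module k M] {x : M} (hx : x ≠ 0) :
    ∃ f : M →ₗ[k] J, f x ≠ 0 :=
  hJ.baer.exists_apply_ne_zero hJ.exists_simple hx

/-- The socle of a minimal injective cogenerator contains each simple module only once. -/
theorem IsMinimalInjectiveCogenerator.mem_span_singleton (hJ : IsMinimalInjectiveCogenerator k J)
    {m : Ideal k} (hm : m.IsMaximal) {x y : J} (hx0 : x ≠ 0) (hx : ∀ a ∈ m, a • x = 0)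
    (hy : ∀ a ∈ m, a • y = 0) : y ∈ Submodule.span k {x} := by
  by_contra hyx
  set K := Submodule.span k {y}
  have hKm : ∀ w ∈ K, ∀ a ∈ m, a • w = 0 := by
    intro w hw a ha
    obtain ⟨r, rfl⟩ := Submodule.mem_span_singleton.1 hw
    rw [smul_comm, hy a ha, smul_zero]
  have hKy : ∀ N : Submodule k J, y ∉ N → Disjoint N K := by
    intro N hyN
    rw [Submodule.disjoint_def]
    intro w hwN hw
    obtain ⟨r, rfl⟩ := Submodule.mem_span_singleton.1 hw
    by_cases hr : r ∈ m
    · exact hy r hr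
    · exfalso
      obtain ⟨s, i, hi, hsi⟩ := hm.exists_inv hr
      apply hyN
      rw [← one_smul k y, ← hsi, add_smul, hy i hi, add_zero, mul_smul]
      exact N.smul_mem s hwN
  -- `N` contains `x` and is maximal among submodules avoiding `k y`. It is a direct summand, hence
  -- injective, and it still contains every simple module, so minimality of `J` forces `N = J`,
  -- which is absurd.
  obtain ⟨N, hxN, hN⟩ := Submodule.exists_le_maximal_disjoint _ _ (hKy _ hyx)
  obtain ⟨p, hp⟩ := hJ.baer.exists_retraction hN
  have hbaer : Module.Baer k N := by
    intro I g
    obtain ⟨g', hg'⟩ := hJ.baer I (N.subtype ∘ₗ g)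
    refine ⟨p ∘ₗ g', fun a ha => ?_⟩
    rw [LinearMap.comp_apply, hg' a ha]
    exact hp _
  have hsimple : ∀ m' : Ideal k, m'.IsMaximal → ∃ z : N, z ≠ 0 ∧ ∀ a ∈ m', a • z = 0 := by
    intro m' hm'
    by_cases hmm : m' = m
    · subst hmm
      refine ⟨⟨x, hxN (Submodule.mem_span_singleton_self x)⟩, ?_, fun a ha => ?_⟩
      · simpa [Subtype.ext_iff] using hx0
      · exact Subtype.ext (hx a ha)
    · obtain ⟨z, hz0, hz⟩ := hJ.exists_simple m' hm'
      by_cases hzN : z ∈ N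
      · exact ⟨⟨z, hzN⟩, by simpa [Subtype.ext_iff] using hz0,
          fun a ha => Subtype.ext (hz a ha)⟩
      · exfalso
        obtain ⟨n, hn, r, hne, hmem⟩ := Submodule.exists_mem_of_maximal_disjoint hN hzN
        -- Such an `a` kills `z` but acts invertibly on `K`, so `a • (n + r • z) = a • n` lies in `N
        -- ∩ K = 0`.
        obtain ⟨a, ha, ham⟩ := Set.not_subset.1 fun h : (m' : Set k) ⊆ m =>
          hmm (hm'.eq_of_le hm.ne_top h)
        have ha' : a • (n + r • z) = a • n := by
          rw [smul_add, smul_comm a r, hz a ha, smul_zero, add_zero]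
        refine hne (eq_zero_of_smul_eq_zero_of_notMem hm (hKm _ hmem) ham ?_)
        refine Submodule.disjoint_def.1 hN.prop _ ?_ (K.smul_mem a hmem)
        rw [ha']
        exact N.smul_mem a hn
  have htop := hJ.minimal N ⟨hbaer.injective, fun M _ _ z hz =>
    hbaer.exists_apply_ne_zero hsimple hz⟩
  subst htop
  have hy0 : y = 0 := Submodule.disjoint_def.1 hN.prop y trivial
    (Submodule.mem_span_singleton_self y)
  exact hyx (hy0 ▸ Submodule.zero_mem _)

/-- A functional is determined by its value at a generator, and this value lies in the `m`-socle of
`J`, which is at most one copy of `k / m`. -/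
theorem IsMinimalInjectiveCogenerator.length_dual_simple_le
    (hJ : IsMinimalInjectiveCogenerator k J) (S : Type*) [AddCommGroup S] [Module k S]
    [IsSimpleModule k S] : Module.length k (S →ₗ[k] J) ≤ 1 := by
  rcases subsingleton_or_nontrivial (S →ₗ[k] J) with h | h
  · rw [Module.length_eq_zero]; exact zero_le_one
  have : Nontrivial S := IsSimpleModule.nontrivial k S
  obtain ⟨s, hs⟩ := exists_ne (0 : S)
  have hsurj := IsSimpleModule.toSpanSingleton_surjective k hs
  have hm : Ideal.IsMaximal (LinearMap.ker (LinearMap.toSpanSingleton k S s)) := by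
    rw [Ideal.isMaximal_def, ← isSimpleModule_iff_isCoatom]
    exact IsSimpleModule.congr (LinearMap.quotKerEquivOfSurjective _ hsurj)
  have hann : ∀ f : S →ₗ[k] J, ∀ a ∈ LinearMap.ker (LinearMap.toSpanSingleton k S s),
      a • f s = 0 := by
    intro f a ha
    have : a • s = 0 := by simpa using ha
    rw [← map_smul, this, map_zero]
  have hext : ∀ f g : S →ₗ[k] J, f s = g s → f = g := by
    intro f g hfg
    ext t
    obtain ⟨r, rfl⟩ := hsurj t
    simp [hfg]
  have : IsSimpleModule k (S →ₗ[k] J) := by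
    rw [isSimpleModule_iff_toSpanSingleton_surjective]
    refine ⟨h, fun f hf g => ?_⟩
    have hfs : f s ≠ 0 := fun h0 => hf (hext f 0 (by simpa using h0))
    obtain ⟨r, hr⟩ := Submodule.mem_span_singleton.1
      (hJ.mem_span_singleton hm hfs (hann f) (hann g))
    exact ⟨r, hext _ _ (by simpa using hr)⟩
  rw [Module.length_eq_one]

theorem IsMinimalInjectiveCogenerator.length_dual_le
    (hJ : IsMinimalInjectiveCogenerator k J) {M : Type*} [AddCommGroup M] [Module k M]
    (hM : IsFiniteLength k M) : Module.length k (M →ₗ[k] J) ≤ Module.length k M := by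
  induction hM with
  | of_subsingleton => simp
  | @of_simple_quotient M _ _ N _ _ ih =>
    have hinj : Function.Injective (LinearMap.lcomp k J N.mkQ) := by
      intro f g hfg
      ext x
      exact LinearMap.congr_fun hfg x
    have hexact : Function.Exact (LinearMap.lcomp k J N.mkQ)
        (LinearMap.lcomp k J N.subtype).rangeRestrict := by
      intro f
      constructor
      · intro hf
        refine ⟨N.liftQ f fun x hx => ?_, ?_⟩
        · exact LinearMap.congr_fun (congrArg Subtype.val hf) ⟨x, hx⟩
        · ext x; rfl
      · rintro ⟨g, rfl⟩
        apply Subtype.ext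
        ext x
        have hx : N.mkQ x = 0 := by simp
        exact (congrArg g hx).trans (map_zero g)
    rw [Module.length_eq_add_of_exact _ _ hinj (LinearMap.surjective_rangeRestrict _) hexact,
      Module.length_eq_add_of_exact N.subtype N.mkQ N.injective_subtype N.mkQ_surjective
        (LinearMap.exact_subtype_mkQ N), add_comm]
    refine add_le_add ?_ ?_
    · refine le_trans (Module.length_le_of_injective (Submodule.subtype _)
        (Submodule.injective_subtype _)) ih
    · rw [Module.length_eq_one k (M ⧸ N)]
      exact hJ.length_dual_simple_le _

theorem LinearMap.bijective_of_injective_of_length_le {M M' : Type*} [AddCommGroup M] [Module k M]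
    [AddCommGroup M'] [Module k M'] {f : M →ₗ[k] M'} (hf : Function.Injective f)
    (hM' : IsFiniteLength k M') (hle : Module.length k M' ≤ Module.length k M) :
    Function.Bijective f := by
  refine ⟨hf, LinearMap.range_eq_top.1 ?_⟩
  by_contra hne
  obtain ⟨_, _⟩ := isFiniteLength_iff_isNoetherian_isArtinian.1 hM'
  have h1 := Submodule.length_lt hne
  rw [← (LinearEquiv.ofInjective f hf).length_eq] at h1
  exact absurd hle (not_le.2 h1)

/-- A pairing with values in a minimal injective cogenerator that is nondegenerate on both sides,
with one side of finite length, is perfect. -/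
theorem IsMinimalInjectiveCogenerator.bijective_of_nondegenerate
    (hJ : IsMinimalInjectiveCogenerator k J) {U V : Type*} [AddCommGroup U] [Module k U]
    [AddCommGroup V] [Module k V] (hV : IsFiniteLength k V) (P : U →ₗ[k] V →ₗ[k] J)
    (hleft : Function.Injective P) (hright : Function.Injective P.flip) :
    Function.Bijective P ∧ Function.Bijective P.flip := by
  -- The lengths satisfy `ℓ(U) ≤ ℓ(DV) ≤ ℓ(V) ≤ ℓ(DU) ≤ ℓ(U)`, so all are equal.
  have hV' := hJ.length_dual_le hV
  have hVfin := Module.length_ne_top_iff.2 hV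
  have hUV := Module.length_le_of_injective P hleft
  have hU : IsFiniteLength k U := by
    rw [← Module.length_ne_top_iff]
    exact ne_top_of_le_ne_top hVfin (hUV.trans hV')
  have hU' := hJ.length_dual_le hU
  have hVU := Module.length_le_of_injective P.flip hright
  have hVD : IsFiniteLength k (V →ₗ[k] J) :=
    Module.length_ne_top_iff.1 (ne_top_of_le_ne_top hVfin hV')
  have hUD : IsFiniteLength k (U →ₗ[k] J) := Module.length_ne_top_iff.1
    (ne_top_of_le_ne_top (Module.length_ne_top_iff.2 hU) hU')
  exact ⟨LinearMap.bijective_of_injective_of_length_le hleft hVD (hV'.trans (hVU.trans hU')),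
    LinearMap.bijective_of_injective_of_length_le hright hUD (hU'.trans (hUV.trans hV'))⟩

end Matlis

/-! ### The radical and direct sums of objects with local endomorphism rings. -/

section Radical

variable {C : Type u} [Category.{v} C] [Preadditive C]

theorem isIso_id_sub_comp_symm {X Y : C} (f : X ⟶ Y) (g : Y ⟶ X) (h : IsIso (𝟙 X - f ≫ g)) :
    IsIso (𝟙 Y - g ≫ f) := by
  have h1 : f ≫ g ≫ inv (𝟙 X - f ≫ g) = inv (𝟙 X - f ≫ g) - 𝟙 X := by
    have := IsIso.hom_inv_id (𝟙 X - f ≫ g)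
    rw [Preadditive.sub_comp, Category.id_comp, Category.assoc] at this
    rw [sub_eq_iff_eq_add] at this
    rw [eq_sub_iff_add_eq, add_comm, ← this]
  have h2 : inv (𝟙 X - f ≫ g) ≫ f ≫ g = inv (𝟙 X - f ≫ g) - 𝟙 X := by
    have := IsIso.inv_hom_id (𝟙 X - f ≫ g)
    rw [Preadditive.comp_sub, Category.comp_id] at this
    rw [sub_eq_iff_eq_add] at this
    rw [eq_sub_iff_add_eq, add_comm, ← this]
  -- The usual inverse `1 + g (1 - fg)⁻¹ f` of `1 - gf`.
  refine ⟨𝟙 Y + g ≫ inv (𝟙 X - f ≫ g) ≫ f, ?_, ?_⟩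
  · have h1' := h1 =≫ f
    simp only [Category.assoc, Preadditive.sub_comp, Category.id_comp] at h1'
    simp only [Preadditive.sub_comp, Preadditive.comp_add, Category.id_comp, Category.comp_id,
      Category.assoc, h1', Preadditive.comp_sub]
    abel
  · have h2' := h2 =≫ f
    simp only [Category.assoc, Preadditive.sub_comp, Category.id_comp] at h2'
    simp only [Preadditive.comp_sub, Preadditive.add_comp, Category.id_comp, Category.comp_id,
      Category.assoc]
    simp only [h2', Preadditive.comp_sub]
    abel

namespace InRadical

variable {X Y Z : C}

theorem comp {f : X ⟶ Y} (hf : InRadical f) (g : Y ⟶ Z) : InRadical (f ≫ g) := by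
  intro h
  rw [Category.assoc]
  exact hf _

theorem precomp (g : X ⟶ Y) {f : Y ⟶ Z} (hf : InRadical f) : InRadical (g ≫ f) := by
  intro h
  rw [Category.assoc]
  refine isIso_id_sub_comp_symm _ _ ?_
  rw [Category.assoc]
  exact hf _

theorem add {f g : X ⟶ Y} (hf : InRadical f) (hg : InRadical g) : InRadical (f + g) := by
  intro h
  have h1 := hf h
  have h2 := hg.precomp (inv (𝟙 X - f ≫ h)) h
  have : 𝟙 X - (f + g) ≫ h
      = (𝟙 X - f ≫ h) ≫ (𝟙 X - (inv (𝟙 X - f ≫ h) ≫ g) ≫ h) := by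
    rw [Preadditive.comp_sub, Category.comp_id, Category.assoc, IsIso.hom_inv_id_assoc,
      Preadditive.add_comp]
    abel
  rw [this]
  infer_instance

theorem zero : InRadical (0 : X ⟶ Y) := by
  intro h
  rw [zero_comp, sub_zero]
  infer_instance

theorem sum {ι : Type*} (s : Finset ι) {f : ι → (X ⟶ Y)} (hf : ∀ i ∈ s, InRadical (f i)) :
    InRadical (∑ i ∈ s, f i) := by
  classical
  induction s using Finset.induction_on with
  | empty => exact zero
  | insert a s ha ih =>
    rw [Finset.sum_insert ha]
    exact (hf a (Finset.mem_insert_self a s)).add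
      (ih fun i hi => hf i (Finset.mem_insert_of_mem hi))

end InRadical

theorem isIso_or_isIso_id_sub {X : C} [IsLocalRing (End X)] (f : X ⟶ X) :
    IsIso f ∨ IsIso (𝟙 X - f) := by
  rcases IsLocalRing.isUnit_or_isUnit_of_add_one (R := End X)
    (add_sub_cancel (show End X from f) 1) with h | h
  · exact Or.inl ((isUnit_iff_isIso _).1 h)
  · exact Or.inr ((isUnit_iff_isIso _).1 h)

theorem not_isIso_zero_of_isLocalRing (X : C) [IsLocalRing (End X)] :
    ¬ IsIso (0 : X ⟶ X) := by
  intro h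
  exact not_isUnit_zero ((isUnit_iff_isIso (0 : End X)).2 h)

theorem not_isZero_of_isLocalRing (X : C) [IsLocalRing (End X)] : ¬ IsZero X := by
  intro h
  have : (0 : X ⟶ X) = 𝟙 X := h.eq_of_src _ _
  exact not_isIso_zero_of_isLocalRing X (this ▸ inferInstance)

/-- Between objects with local endomorphism rings, a morphism `f` with `f ≫ g` invertible for some
`g` is invertible. -/
theorem isIso_of_comp_isIso {X Y : C} [IsLocalRing (End X)] [IsLocalRing (End Y)] (f : X ⟶ Y)
    (g : Y ⟶ X) (h : IsIso (f ≫ g)) : IsIso f := by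
  set r := g ≫ inv (f ≫ g) with hr
  have hfr : f ≫ r = 𝟙 X := by rw [hr, ← Category.assoc, IsIso.hom_inv_id]
  rcases isIso_or_isIso_id_sub (r ≫ f) with h1 | h1
  · refine ⟨r, hfr, ?_⟩
    have : (r ≫ f) ≫ (r ≫ f) = (r ≫ f) ≫ 𝟙 Y := by
      rw [Category.assoc, reassoc_of% hfr, Category.comp_id]
    exact (cancel_epi (r ≫ f)).1 this
  · exfalso
    have h0 : f ≫ (𝟙 Y - r ≫ f) = 0 := by
      rw [Preadditive.comp_sub, Category.comp_id, reassoc_of% hfr, sub_self]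
    have hf0 : f = 0 := by rwa [← cancel_mono (𝟙 Y - r ≫ f), zero_comp]
    have : (0 : X ⟶ X) = 𝟙 X := by rw [← hfr, hf0, zero_comp]
    exact not_isIso_zero_of_isLocalRing X (this ▸ inferInstance)

theorem inRadical_of_not_isIso {X Y : C} [IsLocalRing (End X)] [IsLocalRing (End Y)] {f : X ⟶ Y}
    (hf : ¬ IsIso f) : InRadical f := by
  intro g
  exact (isIso_or_isIso_id_sub (f ≫ g)).resolve_left fun h => hf (isIso_of_comp_isIso f g h)

theorem isLocalRing_end_of_iso {X Y : C} (e : X ≅ Y) [IsLocalRing (End Y)] :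
    IsLocalRing (End X) := by
  have : Nontrivial (End X) := by
    refine ⟨0, 1, fun h => not_isIso_zero_of_isLocalRing Y ?_⟩
    have : (0 : Y ⟶ Y) = e.inv ≫ (0 : X ⟶ X) ≫ e.hom := by simp
    have h' : (0 : X ⟶ X) = 𝟙 X := h
    rw [this, h']
    infer_instance
  refine IsLocalRing.of_isUnit_or_isUnit_one_sub_self fun a => ?_
  have key : ∀ b : X ⟶ X, IsIso (e.inv ≫ b ≫ e.hom) → IsIso b := by
    intro b hb
    have : b = e.hom ≫ (e.inv ≫ b ≫ e.hom) ≫ e.inv := by simp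
    rw [this]
    infer_instance
  rcases isIso_or_isIso_id_sub (e.inv ≫ (show X ⟶ X from a) ≫ e.hom) with h | h
  · exact Or.inl ((isUnit_iff_isIso _).2 (key _ h))
  · refine Or.inr ((isUnit_iff_isIso _).2 (key _ ?_))
    have : e.inv ≫ (𝟙 X - (show X ⟶ X from a)) ≫ e.hom =
        𝟙 Y - e.inv ≫ (show X ⟶ X from a) ≫ e.hom := by
      simp [Preadditive.comp_sub, Preadditive.sub_comp]
    exact this ▸ h

variable [HasFiniteBiproducts C]

/-- `X` is a direct sum of `m` objects with local endomorphism rings. -/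
def HasLocalDecomposition (X : C) (m : ℕ) : Prop :=
  ∃ (ι : Type) (_ : Fintype ι) (Y : ι → C), Fintype.card ι = m ∧
    (∀ i, IsLocalRing (End (Y i))) ∧ Nonempty (X ≅ ⨁ Y)

theorem IsKrullSchmidt.hasLocalDecomposition (h : IsKrullSchmidt C) (X : C) :
    ∃ m, HasLocalDecomposition X m := by
  obtain ⟨m, Y, hY, e⟩ := h X
  exact ⟨m, Fin m, inferInstance, Y, Fintype.card_fin m, hY, e⟩

theorem inRadical_of_components {ι κ : Type} [Fintype ι] [Fintype κ] {Y : ι → C} {Z : κ → C}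
    [∀ i, IsLocalRing (End (Y i))] [∀ j, IsLocalRing (End (Z j))] (f : ⨁ Y ⟶ ⨁ Z)
    (hf : ∀ i j, ¬ IsIso (biproduct.ι Y i ≫ f ≫ biproduct.π Z j)) : InRadical f := by
  have : f = ∑ i, ∑ j, biproduct.π Y i ≫
      ((biproduct.ι Y i ≫ f ≫ biproduct.π Z j) ≫ biproduct.ι Z j) := by
    calc f = 𝟙 _ ≫ f ≫ 𝟙 _ := by simp
      _ = _ := by
        rw [← biproduct.total, ← biproduct.total, Preadditive.sum_comp]
        simp only [Preadditive.comp_sum, Category.assoc]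
  rw [this]
  exact InRadical.sum _ fun i _ => InRadical.sum _ fun j _ =>
    ((inRadical_of_not_isIso (hf i j)).comp _).precomp _

/-- A morphism that is not in the radical contains an isomorphism between summands of two given
decompositions into objects with local endomorphism rings. -/
theorem exists_isIso_of_not_inRadical {U V : C} {ι κ : Type} [Fintype ι] [Fintype κ] {Y : ι → C}
    {Z : κ → C} [∀ i, IsLocalRing (End (Y i))] [∀ j, IsLocalRing (End (Z j))] (e : U ≅ ⨁ Y)
    (e' : V ≅ ⨁ Z) (f : U ⟶ V) (hf : ¬ InRadical f) :
    ∃ i j, IsIso ((biproduct.ι Y i ≫ e.inv) ≫ f ≫ e'.hom ≫ biproduct.π Z j) := by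
  by_contra! h
  apply hf
  have h1 := inRadical_of_components (e.inv ≫ f ≫ e'.hom) fun i j => by
    simpa only [Category.assoc] using h i j
  have h2 := (h1.comp e'.inv).precomp e.hom
  simpa using h2

open scoped Classical in
theorem biproduct_toSubtype_fromSubtype_ne {ι : Type} [Fintype ι] (Y : ι → C) (i : ι) :
    biproduct.toSubtype Y (· ≠ i) ≫ biproduct.fromSubtype Y (· ≠ i) =
      𝟙 _ - biproduct.π Y i ≫ biproduct.ι Y i := by
  rw [biproduct.toSubtype_fromSubtype]
  ext a b
  by_cases ha : a = i
  · subst ha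
    simp [Preadditive.sub_comp]
  · by_cases hab : a = b
    · subst hab
      simp [ha, Preadditive.comp_sub, Preadditive.sub_comp]
    · by_cases hb : b = i
      · subst hb
        simp [ha, Preadditive.sub_comp, biproduct.ι_π_ne _ (Ne.symm hab)]
      · simp [ha, Preadditive.comp_sub, Preadditive.sub_comp, biproduct.ι_π_ne_assoc _ hb]

/-- The complement of a summand `Y i` for any retraction `q` of its inclusion. -/
theorem exists_splitting_of_retraction {X : C} {ι : Type} [Fintype ι] {Y : ι → C}
    [∀ i, IsLocalRing (End (Y i))] (e : X ≅ ⨁ Y) (i : ι) (q : X ⟶ Y i)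
    (hq : (biproduct.ι Y i ≫ e.inv) ≫ q = 𝟙 _) :
    ∃ (X' : C) (s : X' ⟶ X) (r : X ⟶ X'), s ≫ r = 𝟙 _ ∧
      r ≫ s = 𝟙 _ - q ≫ biproduct.ι Y i ≫ e.inv ∧
      HasLocalDecomposition X' (Fintype.card ι - 1) := by
  classical
  refine ⟨⨁ Subtype.restrict (· ≠ i) Y,
    -- The complement is always the sum of the other `Y j`; only its inclusion is corrected, to land
    -- in the kernel of `q`. Thus the summand count drops by one without any appeal to uniqueness of
    -- decompositions.
    biproduct.fromSubtype Y (· ≠ i) ≫ e.inv ≫ (𝟙 _ - q ≫ biproduct.ι Y i ≫ e.inv),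
    e.hom ≫ biproduct.toSubtype Y (· ≠ i), ?_, ?_, ?_⟩
  · have : biproduct.ι Y i ≫ biproduct.toSubtype Y (· ≠ i) = 0 := by
      rw [biproduct.ι_toSubtype]; simp
    simp [Preadditive.comp_sub, Preadditive.sub_comp, this]
  · have h := biproduct_toSubtype_fromSubtype_ne Y i
    rw [Category.assoc, reassoc_of% h]
    rw [Category.assoc] at hq
    simp [Preadditive.comp_sub, Preadditive.sub_comp, reassoc_of% hq]
  · exact ⟨{j // j ≠ i}, inferInstance, _, by simp, fun j =>
      inferInstanceAs (IsLocalRing (End (Y j.1))), ⟨Iso.refl _⟩⟩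

/-- The complement of a summand `Y i` for any section `t` of its projection. -/
theorem exists_splitting_of_section {X : C} {ι : Type} [Fintype ι] {Y : ι → C}
    [∀ i, IsLocalRing (End (Y i))] (e : X ≅ ⨁ Y) (i : ι) (t : Y i ⟶ X)
    (ht : t ≫ e.hom ≫ biproduct.π Y i = 𝟙 _) :
    ∃ (X' : C) (s : X' ⟶ X) (r : X ⟶ X'), s ≫ r = 𝟙 _ ∧
      r ≫ s = 𝟙 _ - (e.hom ≫ biproduct.π Y i) ≫ t ∧
      HasLocalDecomposition X' (Fintype.card ι - 1) := by
  classical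
  refine ⟨⨁ Subtype.restrict (· ≠ i) Y,
    biproduct.fromSubtype Y (· ≠ i) ≫ e.inv,
    (𝟙 _ - (e.hom ≫ biproduct.π Y i) ≫ t) ≫ e.hom ≫ biproduct.toSubtype Y (· ≠ i), ?_, ?_, ?_⟩
  · have : biproduct.fromSubtype Y (· ≠ i) ≫ biproduct.π Y i = 0 := by
      rw [biproduct.fromSubtype_π]; simp
    simp [Preadditive.comp_sub, Preadditive.sub_comp, reassoc_of% this]
  · have h := biproduct_toSubtype_fromSubtype_ne Y i
    simp only [Category.assoc, reassoc_of% h]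
    simp [Preadditive.comp_sub, Preadditive.sub_comp, reassoc_of% ht]
  · exact ⟨{j // j ≠ i}, inferInstance, _, by simp, fun j =>
      inferInstanceAs (IsLocalRing (End (Y j.1))), ⟨Iso.refl _⟩⟩

/-- In a Krull–Schmidt category, indecomposable objects have local endomorphism rings. -/
theorem IsKrullSchmidt.isLocalRing_end (h : IsKrullSchmidt C) {X : C} (hX : Indecomposable X) :
    IsLocalRing (End X) := by
  obtain ⟨m, Y, hY, ⟨e⟩⟩ := h X
  rcases Nat.eq_zero_or_pos m with rfl | hm
  · exact absurd (IsZero.of_iso (by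
      rw [IsZero.iff_id_eq_zero]; ext i; exact i.elim0) e) hX.1
  -- Splitting off one local summand leaves a complement, which vanishes by indecomposability.
  let i : Fin m := ⟨0, hm⟩
  obtain ⟨X', s, r, hsr, hrs, -⟩ := exists_splitting_of_retraction e i
    (e.hom ≫ biproduct.π Y i) (by simp)
  have hιq : (biproduct.ι Y i ≫ e.inv) ≫ e.hom ≫ biproduct.π Y i = 𝟙 _ := by simp
  generalize e.hom ≫ biproduct.π Y i = q at hrs hιq
  generalize biproduct.ι Y i ≫ e.inv = t at hrs hιq
  have htr : t ≫ r = 0 := by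
    have h1 : (t ≫ r) ≫ s = 0 := by
      rw [Category.assoc, hrs, Preadditive.comp_sub, Category.comp_id, reassoc_of% hιq, sub_self]
    rw [← Category.comp_id (t ≫ r), ← hsr, ← Category.assoc, h1, zero_comp]
  have hsq : s ≫ q = 0 := by
    have h1 : r ≫ s ≫ q = 0 := by
      rw [reassoc_of% hrs, Preadditive.sub_comp, Category.id_comp, Category.assoc, hιq,
        Category.comp_id, sub_self]
    rw [← Category.id_comp (s ≫ q), ← hsr, Category.assoc, h1, comp_zero]
  let E : X ≅ Y i ⊞ X' :=
    { hom := biprod.lift q r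
      inv := biprod.desc t s
      hom_inv_id := by rw [biprod.lift_desc, hrs]; abel
      inv_hom_id := by ext <;> simp [hιq, htr, hsq, hsr] }
  have hYi := hY i
  rcases hX.2 _ _ E with h0 | h0
  · exact absurd h0 (not_isZero_of_isLocalRing _)
  · have hr : r = 0 := h0.eq_of_tgt _ _
    have hqt : q ≫ t = 𝟙 X := by
      rw [hr, zero_comp] at hrs
      exact (sub_eq_zero.1 hrs.symm).symm
    exact isLocalRing_end_of_iso ⟨q, t, hqt, hιq⟩

end Radical

/-! ### Making the inner differentials radical. -/

section Minimal

variable {C : Type u} [Category.{v} C] [Preadditive C]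

/-- The complex obtained by splitting an idempotent endomorphism `e` of `K` degreewise. -/
def splitComplex (K : CochainComplex C ℕ) (e : K ⟶ K) (Y : ℕ → C) (s : ∀ i, Y i ⟶ K.X i)
    (r : ∀ i, K.X i ⟶ Y i) (hrs : ∀ i, r i ≫ s i = e.f i) : CochainComplex C ℕ where
  X := Y
  d i j := s i ≫ K.d i j ≫ r j
  shape i j hij := by rw [K.shape i j hij, zero_comp, comp_zero]
  d_comp_d' i j l _ _ := by
    simp only [Category.assoc]
    rw [reassoc_of% (hrs j), e.comm_assoc, K.d_comp_d_assoc, zero_comp, comp_zero]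

/-- The split complex is homotopy equivalent to the given one if `e` is homotopic to `𝟙`. -/
def splitComplexHomotopyEquiv (K : CochainComplex C ℕ) (e : K ⟶ K) (Y : ℕ → C)
    (s : ∀ i, Y i ⟶ K.X i) (r : ∀ i, K.X i ⟶ Y i) (hsr : ∀ i, s i ≫ r i = 𝟙 (Y i))
    (hrs : ∀ i, r i ≫ s i = e.f i) (H : Homotopy e (𝟙 K)) :
    HomotopyEquiv K (splitComplex K e Y s r hrs) where
  hom :=
    { f := r
      comm' := fun i j _ => by
        change r i ≫ s i ≫ K.d i j ≫ r j = K.d i j ≫ r j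
        rw [reassoc_of% (hrs i), e.comm_assoc, ← hrs j, Category.assoc, hsr, Category.comp_id] }
  inv :=
    { f := s
      comm' := fun i j _ => by
        change s i ≫ K.d i j = (s i ≫ K.d i j ≫ r j) ≫ s j
        rw [Category.assoc, Category.assoc, hrs j, ← e.comm, ← hrs i, Category.assoc, reassoc_of% (hsr i)] }
  homotopyHomInvId := (Homotopy.ofEq (by ext i; exact hrs i)).trans H
  homotopyInvHomId := Homotopy.ofEq (by ext i; exact hsr i)

namespace NComplex

variable {n : ℕ} {A B : C}

/-- Splitting off contractible summands away from the ends. -/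
theorem exists_homotopyEquivalent_of_splitting (X : NComplex n A B) (e : X.cx ⟶ X.cx)
    (H : Homotopy e (𝟙 X.cx)) (h0 : e.f 0 = 𝟙 _) (h1 : e.f (n + 1) = 𝟙 _) (Y : ℕ → C)
    (s : ∀ i, Y i ⟶ X.cx.X i) (r : ∀ i, X.cx.X i ⟶ Y i) (hsr : ∀ i, s i ≫ r i = 𝟙 (Y i))
    (hrs : ∀ i, r i ≫ s i = e.f i) :
    ∃ X' : NComplex n A B, HomotopyEquivalent X X' ∧ X'.cx.X = Y := by
  let l : Y 0 ≅ X.cx.X 0 := ⟨s 0, r 0, hsr 0, (hrs 0).trans h0⟩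
  let l' : Y (n + 1) ≅ X.cx.X (n + 1) := ⟨s _, r _, hsr _, (hrs _).trans h1⟩
  refine ⟨⟨splitComplex X.cx e Y s r hrs, fun i hi => ?_, l ≪≫ X.left, l' ≪≫ X.right⟩,
    ⟨splitComplexHomotopyEquiv X.cx e Y s r hsr hrs H, ⟨?_, ?_⟩, ⟨?_, ?_⟩⟩, rfl⟩
  · rw [IsZero.iff_id_eq_zero]
    change 𝟙 (Y i) = 0
    rw [← hsr i, (X.isZero i hi).eq_of_tgt (s i) 0, zero_comp]
  · change r 0 ≫ s 0 ≫ X.left.hom = _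
    rw [reassoc_of% (hrs 0), h0, Category.id_comp, Category.comp_id]
  · change r (n + 1) ≫ s (n + 1) ≫ X.right.hom = _
    rw [reassoc_of% (hrs (n + 1)), h1, Category.id_comp, Category.comp_id]
  · change s 0 ≫ X.left.hom = (s 0 ≫ X.left.hom) ≫ 𝟙 A
    rw [Category.comp_id]
  · change s (n + 1) ≫ X.right.hom = (s (n + 1) ≫ X.right.hom) ≫ 𝟙 B
    rw [Category.comp_id]

end NComplex

/-- A morphism `h : Kᵖ⁺¹ ⟶ Kᵖ` as a family of morphisms that vanishes elsewhere. -/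
def singleHomotopy (K : CochainComplex C ℕ) (p : ℕ) (h : K.X (p + 1) ⟶ K.X p) (i j : ℕ) :
    K.X i ⟶ K.X j :=
  if hij : p + 1 = i ∧ p = j then
    eqToHom (congrArg K.X hij.1.symm) ≫ h ≫ eqToHom (congrArg K.X hij.2) else 0

theorem singleHomotopy_self (K : CochainComplex C ℕ) (p : ℕ) (h : K.X (p + 1) ⟶ K.X p) :
    singleHomotopy K p h (p + 1) p = h := by
  simp [singleHomotopy]

theorem singleHomotopy_eq_zero (K : CochainComplex C ℕ) (p : ℕ) (h : K.X (p + 1) ⟶ K.X p)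
    {i j : ℕ} (hij : ¬ (p + 1 = i ∧ p = j)) : singleHomotopy K p h i j = 0 :=
  dif_neg hij

/-- A morphism `h : Kᵖ⁺¹ ⟶ Kᵖ` gives an endomorphism of `K` that is homotopic to the identity. -/
theorem exists_homotopy_id (K : CochainComplex C ℕ) (p : ℕ) (h : K.X (p + 1) ⟶ K.X p) :
    ∃ e : K ⟶ K, Nonempty (Homotopy e (𝟙 K)) ∧ e.f p = 𝟙 _ - K.d p (p + 1) ≫ h ∧
      e.f (p + 1) = 𝟙 _ - h ≫ K.d p (p + 1) ∧ ∀ i, i ≠ p → i ≠ p + 1 → e.f i = 𝟙 _ := by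
  set H := singleHomotopy K p h with hH
  have hprev : ∀ i, i ≠ p + 1 → prevD i H = 0 := by
    intro i hi
    cases i with
    | zero => exact Homotopy.prevD_zero_cochainComplex _
    | succ i =>
      rw [Homotopy.prevD_succ_cochainComplex, hH, singleHomotopy_eq_zero _ _ _ (by omega), zero_comp]
  have hnext : ∀ i, i ≠ p → dNext i H = 0 := by
    intro i hi
    rw [Homotopy.dNext_cochainComplex, hH, singleHomotopy_eq_zero _ _ _ (by omega), comp_zero]
  have hf : ∀ i, (𝟙 K - Homotopy.nullHomotopicMap H).f i = 𝟙 _ - (dNext i H + prevD i H) :=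
    fun i => rfl
  have h0 : Homotopy (Homotopy.nullHomotopicMap H) 0 :=
    Homotopy.nullHomotopy H fun i j hij => singleHomotopy_eq_zero _ _ _ fun hh => hij (by
      rw [← hh.1, ← hh.2]; simp)
  refine ⟨𝟙 K - Homotopy.nullHomotopicMap H, ⟨(Homotopy.equivSubZero.symm
    ((Homotopy.ofEq (sub_sub_cancel _ _)).trans h0)).symm⟩, ?_, ?_, ?_⟩
  · rw [hf, hprev p (by omega), Homotopy.dNext_cochainComplex, hH, singleHomotopy_self, add_zero]
  · rw [hf, hnext (p + 1) (by omega), Homotopy.prevD_succ_cochainComplex, hH, singleHomotopy_self, zero_add]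
  · intro i h1 h2
    rw [hf, hprev i h2, hnext i h1, add_zero, sub_zero]

variable [HasFiniteBiproducts C]

/-- The least number of summands with local endomorphism rings. -/
def localCount (X : C) : ℕ :=
  sInf {m | HasLocalDecomposition X m}

theorem HasLocalDecomposition.localCount_le {X : C} {m : ℕ} (h : HasLocalDecomposition X m) :
    localCount X ≤ m :=
  Nat.sInf_le h

theorem IsKrullSchmidt.hasLocalDecomposition_localCount (h : IsKrullSchmidt C) (X : C) :
    HasLocalDecomposition X (localCount X) :=
  Nat.sInf_mem (h.hasLocalDecomposition X)

namespace NComplex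

variable {n : ℕ} {A B : C}

/-- The number of indecomposable summands of the terms of a complex. -/
def size (X : NComplex n A B) : ℕ :=
  ∑ i ∈ Finset.range (n + 2), localCount (X.cx.X i)

/-- A nonradical differential contains an isomorphism between local summands; this two-term
contractible piece can be split off. -/
theorem exists_size_lt (hKS : IsKrullSchmidt C) (X : NComplex n A B) {p : ℕ} (hp : 1 ≤ p)
    (hpn : p < n) (hrad : ¬ InRadical (X.cx.d p (p + 1))) :
    ∃ X' : NComplex n A B, HomotopyEquivalent X X' ∧ X'.size < X.size := by
  obtain ⟨ι, _, U, hUcard, hU, ⟨e⟩⟩ := hKS.hasLocalDecomposition_localCount (X.cx.X p)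
  obtain ⟨κ, _, V, hVcard, hV, ⟨e'⟩⟩ := hKS.hasLocalDecomposition_localCount (X.cx.X (p + 1))
  obtain ⟨i, j, hij⟩ := exists_isIso_of_not_inRadical e e' _ hrad
  set d := X.cx.d p (p + 1)
  set a := biproduct.ι U i ≫ e.inv with ha
  set b := e'.hom ≫ biproduct.π V j with hb
  -- The homotopy inverts the invertible component `a ≫ d ≫ b`, so `E` is idempotent and projects
  -- away the contractible piece.
  obtain ⟨E, ⟨H⟩, hEp, hEp', hE⟩ := exists_homotopy_id X.cx p (b ≫ inv (a ≫ d ≫ b) ≫ a)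
  have hq : a ≫ (d ≫ b ≫ inv (a ≫ d ≫ b)) = 𝟙 _ := by
    have := IsIso.hom_inv_id (a ≫ d ≫ b)
    simpa only [Category.assoc] using this
  have ht : (inv (a ≫ d ≫ b) ≫ a ≫ d) ≫ b = 𝟙 _ := by
    have := IsIso.inv_hom_id (a ≫ d ≫ b)
    simpa only [Category.assoc] using this
  have hιpos : 0 < Fintype.card ι := Fintype.card_pos_iff.2 ⟨i⟩
  have key : ∀ l, ∃ (Y : C) (s : Y ⟶ X.cx.X l) (r : X.cx.X l ⟶ Y), s ≫ r = 𝟙 _ ∧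
      r ≫ s = E.f l ∧ localCount Y ≤ localCount (X.cx.X l) ∧
      (l = p → localCount Y < localCount (X.cx.X l)) := by
    intro l
    by_cases hl : l = p
    · subst hl
      obtain ⟨Y, s, r, h1, h2, h3⟩ := exists_splitting_of_retraction e i _ hq
      have := h3.localCount_le
      refine ⟨Y, s, r, h1, ?_, by omega, fun _ => by omega⟩
      rw [h2, hEp]
      simp only [d, a, Category.assoc]
    · by_cases hl' : l = p + 1
      · subst hl'
        obtain ⟨Y, s, r, h1, h2, h3⟩ := exists_splitting_of_section e' j _ ht
        have := h3.localCount_le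
        refine ⟨Y, s, r, h1, ?_, by omega, fun h => absurd h (by omega)⟩
        rw [h2, hEp']
        simp only [d, b, Category.assoc]
      · exact ⟨_, 𝟙 _, 𝟙 _, by simp, by rw [hE l hl hl', Category.comp_id], le_rfl,
          fun h => absurd h hl⟩
  choose Y s r hsr hrs hle hlt using key
  -- Since `1 ≤ p < n`, the degrees `p` and `p + 1` avoid `0` and `n + 1`, so the ends are
  -- untouched.
  obtain ⟨X', hX', hXY⟩ := X.exists_homotopyEquivalent_of_splitting E H
    (hE 0 (by omega) (by omega)) (hE (n + 1) (by omega) (by omega)) Y s r hsr hrs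
  refine ⟨X', hX', ?_⟩
  rw [size, size, hXY]
  exact Finset.sum_lt_sum (fun l _ => hle l) ⟨p, Finset.mem_range.2 (by omega), hlt p rfl⟩

/-- In a Krull–Schmidt category, every complex is homotopy equivalent, relative to its ends, to
one whose inner differentials are in the radical. -/
theorem exists_homotopyEquivalent_inRadical (hKS : IsKrullSchmidt C) (X : NComplex n A B) :
    ∃ X' : NComplex n A B, HomotopyEquivalent X X' ∧
      ∀ i, 1 ≤ i → i < n → InRadical (X'.cx.d i (i + 1)) := by
  induction hm : X.size using Nat.strong_induction_on generalizing X with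
  | _ m ih =>
    by_cases h : ∀ i, 1 ≤ i → i < n → InRadical (X.cx.d i (i + 1))
    · exact ⟨X, (homotopyEquivalent_equivalence n A B).refl X, h⟩
    · push Not at h
      obtain ⟨p, hp, hpn, hrad⟩ := h
      obtain ⟨X₁, hX₁, hsize⟩ := X.exists_size_lt hKS hp hpn hrad
      obtain ⟨X₂, hX₂, h₂⟩ := ih _ (hm ▸ hsize) X₁ rfl
      exact ⟨X₂, (homotopyEquivalent_equivalence n A B).trans hX₁ hX₂, h₂⟩

end NComplex

end Minimal

/-! ### The action on extensions over local endomorphism rings. -/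

section Bifunctor

variable {k : Type uk} [CommRing k] {C : Type u} [Category.{v} C]
  (𝔼 : Cᵒᵖ ⥤ C ⥤ ModuleCat.{w} k)

theorem pushExt_id_apply {A B : C} (δ : Extn 𝔼 B A) : pushExt 𝔼 (𝟙 A) δ = δ := by
  simp [pushExt]

theorem pullExt_id_apply {A B : C} (δ : Extn 𝔼 B A) : pullExt 𝔼 (𝟙 B) δ = δ := by
  simp [pullExt]

theorem pushExt_pullExt {A A' B B' : C} (a : A ⟶ A') (b : B' ⟶ B) (δ : Extn 𝔼 B A) :
    pushExt 𝔼 a (pullExt 𝔼 b δ) = pullExt 𝔼 b (pushExt 𝔼 a δ) := by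
  have h := congrArg (fun f => f.hom δ) ((𝔼.map b.op).naturality a)
  exact h.symm

variable [Preadditive C] [Linear k C] [IsBilinearBifunctor 𝔼]

theorem pushExt_zero_apply {A A' B : C} (δ : Extn 𝔼 B A) :
    pushExt 𝔼 (0 : A ⟶ A') δ = 0 := by
  have h := IsBilinearBifunctor.push_smul (𝔼 := 𝔼) (0 : k) (0 : A ⟶ A') δ
  simpa using h

theorem pullExt_zero_apply {A B B' : C} (δ : Extn 𝔼 B A) :
    pullExt 𝔼 (0 : B' ⟶ B) δ = 0 := by
  have h := IsBilinearBifunctor.pull_smul (𝔼 := 𝔼) (0 : k) (0 : B' ⟶ B) δ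
  simpa using h

/-- The action of morphisms on the second argument of `𝔼`, as a bilinear map. -/
def pushBilin (A A' B : C) : (A ⟶ A') →ₗ[k] Extn 𝔼 B A →ₗ[k] Extn 𝔼 B A' :=
  LinearMap.mk₂ k (fun a δ => pushExt 𝔼 a δ) IsBilinearBifunctor.push_add
    (fun r a δ => IsBilinearBifunctor.push_smul r a δ) (fun _ => map_add _)
    (fun r a => map_smul (pushExt 𝔼 a) r)

/-- The action of morphisms on the first argument of `𝔼`, as a bilinear map. -/
def pullBilin (A B B' : C) : (B' ⟶ B) →ₗ[k] Extn 𝔼 B A →ₗ[k] Extn 𝔼 B' A :=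
  LinearMap.mk₂ k (fun b δ => pullExt 𝔼 b δ) IsBilinearBifunctor.pull_add
    (fun r a δ => IsBilinearBifunctor.pull_smul r a δ) (fun _ => map_add _)
    (fun r a => map_smul (pullExt 𝔼 a) r)

theorem pushExt_eq_zero_of_isIso_id_sub {A B : C} {a : A ⟶ A} (ha : IsIso (𝟙 A - a))
    {δ : Extn 𝔼 B A} (h : pushExt 𝔼 a δ = δ) : δ = 0 := by
  have h0 : pushExt 𝔼 (𝟙 A - a) δ = 0 := by
    have := LinearMap.congr_fun (map_sub (pushBilin 𝔼 A A B) (𝟙 A) a) δ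
    refine this.trans (sub_eq_zero.2 ?_)
    exact (pushExt_id_apply 𝔼 δ).trans h.symm
  rw [← pushExt_id_apply 𝔼 δ, ← IsIso.hom_inv_id (𝟙 A - a), pushExt_comp_apply, h0, map_zero]

theorem pullExt_eq_zero_of_isIso_id_sub {A B : C} {b : B ⟶ B} (hb : IsIso (𝟙 B - b))
    {δ : Extn 𝔼 B A} (h : pullExt 𝔼 b δ = δ) : δ = 0 := by
  have h0 : pullExt 𝔼 (𝟙 B - b) δ = 0 := by
    have := LinearMap.congr_fun (map_sub (pullBilin 𝔼 A B B) (𝟙 B) b) δ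
    refine this.trans (sub_eq_zero.2 ?_)
    exact (pullExt_id_apply 𝔼 δ).trans h.symm
  rw [← pullExt_id_apply 𝔼 δ, ← IsIso.inv_hom_id (𝟙 B - b), pullExt_comp_apply, h0, map_zero]

/-- As `g ≫ h` fixes `δ ≠ 0`, the morphism `1 - g ≫ h` is not invertible; locality makes `g ≫ h`
invertible. -/
theorem isSplitMono_of_pushExt_comp {A B Z : C} [IsLocalRing (End A)] {δ : Extn 𝔼 B A}
    (hδ : δ ≠ 0) (g : A ⟶ Z) (h : Z ⟶ A) (hgh : pushExt 𝔼 h (pushExt 𝔼 g δ) = δ) :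
    IsSplitMono g := by
  rw [← pushExt_comp_apply] at hgh
  rcases isIso_or_isIso_id_sub (g ≫ h) with h1 | h1
  · exact ⟨⟨h ≫ inv (g ≫ h), by rw [← Category.assoc, IsIso.hom_inv_id]⟩⟩
  · exact absurd (pushExt_eq_zero_of_isIso_id_sub 𝔼 h1 hgh) hδ

theorem isSplitEpi_of_pullExt_comp {A B Z : C} [IsLocalRing (End B)] {δ : Extn 𝔼 B A}
    (hδ : δ ≠ 0) (g : Z ⟶ B) (h : B ⟶ Z) (hgh : pullExt 𝔼 h (pullExt 𝔼 g δ) = δ) :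
    IsSplitEpi g := by
  rw [← pullExt_comp_apply] at hgh
  rcases isIso_or_isIso_id_sub (h ≫ g) with h1 | h1
  · exact ⟨⟨inv (h ≫ g) ≫ h, by rw [Category.assoc, IsIso.inv_hom_id]⟩⟩
  · exact absurd (pullExt_eq_zero_of_isIso_id_sub 𝔼 h1 hgh) hδ

end Bifunctor

/-! ### Minimal orbits. -/

section Socle

/-- A nonzero Artinian module with operators has an element generating a minimal submodule. -/
theorem IsArtinian.exists_minimal_orbit {k : Type*} [CommRing k] {M V : Type*} [AddCommGroup M]
    [Module k M] [AddCommGroup V] [Module k V] [IsArtinian k M] [Nontrivial M]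
    (act : V →ₗ[k] M →ₗ[k] M) (hone : ∃ a, ∀ x, act a x = x)
    (hmul : ∀ a b, ∃ c, ∀ x, act c x = act a (act b x)) :
    ∃ x : M, x ≠ 0 ∧ ∀ b, act b x ≠ 0 → ∃ a, act a (act b x) = x := by
  obtain ⟨x₀, hx₀⟩ := exists_ne (0 : M)
  obtain ⟨_, ⟨x, hx, rfl⟩, hmin⟩ := IsArtinian.set_has_minimal
    {N : Submodule k M | ∃ x, x ≠ 0 ∧ LinearMap.range (act.flip x) = N} ⟨_, x₀, hx₀, rfl⟩
  refine ⟨x, hx, fun b hb => ?_⟩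
  have hle : LinearMap.range (act.flip (act b x)) ≤ LinearMap.range (act.flip x) := by
    rintro _ ⟨a, rfl⟩
    obtain ⟨c, hc⟩ := hmul a b
    exact ⟨c, hc x⟩
  have heq := hle.eq_of_not_lt (hmin _ ⟨_, hb, rfl⟩)
  obtain ⟨a, ha⟩ := hone
  have hmem : x ∈ LinearMap.range (act.flip (act b x)) := heq ▸ ⟨a, ha x⟩
  exact hmem

end Socle

/-! ### Exactness of `𝔼` along conflations, and almost split extensions. -/

section Exactness

variable {k : Type uk} [CommRing k] {C : Type u} [Category.{v} C] [Preadditive C]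
  {𝔼 : Cᵒᵖ ⥤ C ⥤ ModuleCat.{w} k} {n : ℕ}

theorem ExtnRealization.exists_realizes (s : ExtnRealization 𝔼 n) {A B : C} (δ : Extn 𝔼 B A) :
    ∃ X : NComplex n A B, s.Realizes X δ := by
  obtain ⟨X, hX⟩ := Quotient.exists_rep (s A B δ)
  exact ⟨X, hX.symm⟩

theorem ExtnRealization.Realizes.of_homotopyEquivalent {s : ExtnRealization 𝔼 n} {A B : C}
    {δ : Extn 𝔼 B A} {X X' : NComplex n A B} (h : s.Realizes X δ)
    (hX : NComplex.HomotopyEquivalent X X') : s.Realizes X' δ :=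
  Eq.trans h (Quotient.sound hX)

namespace IsNExangle

variable {A B : C} {X : NComplex n A B} {δ : Extn 𝔼 B A}

theorem not_isSplitMono_first (h : IsNExangle 𝔼 X δ) (hδ : δ ≠ 0) : ¬ IsSplitMono X.first := by
  intro hs
  apply hδ
  rw [← pushExt_id_apply 𝔼 δ, ← IsSplitMono.id X.first, pushExt_comp_apply, h.push_first, map_zero]

theorem not_isSplitEpi_last (h : IsNExangle 𝔼 X δ) (hδ : δ ≠ 0) : ¬ IsSplitEpi X.last := by
  intro hs
  apply hδ
  rw [← pullExt_id_apply 𝔼 δ, ← IsSplitEpi.id X.last, pullExt_comp_apply, h.pull_last, map_zero]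

end IsNExangle

variable [HasFiniteBiproducts C] {hn : 1 ≤ n} {s : ExtnRealization 𝔼 n}

/-- An extension that is annihilated by all nonsections and nonretractions is realized by an
Auslander–Reiten `n`-exangle. -/
theorem IsNExangulated.exists_isAuslanderReiten (hs : IsNExangulated hn 𝔼 s) (hKS : IsKrullSchmidt C) {A B : C}
    {δ : Extn 𝔼 B A} (hδ : δ ≠ 0)
    (hpush : ∀ ⦃Z : C⦄ (g : A ⟶ Z), ¬ IsSplitMono g → pushExt 𝔼 g δ = 0)
    (hpull : ∀ ⦃Z : C⦄ (g : Z ⟶ B), ¬ IsSplitEpi g → pullExt 𝔼 g δ = 0) :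
    ∃ X : NComplex n A B, IsAuslanderReiten s X δ := by
  obtain ⟨X₀, hX₀⟩ := s.exists_realizes δ
  obtain ⟨X, hX₀X, hrad⟩ := X₀.exists_homotopyEquivalent_inRadical hKS
  have hX := hX₀.of_homotopyEquivalent hX₀X
  have hex := hs.exangle δ X hX
  exact ⟨X, hX, ⟨hex.not_isSplitMono_first hδ, fun Z g hg => hex.exact_from_end Z g (hpush g hg)⟩,
    ⟨hex.not_isSplitEpi_last hδ, fun Z g hg => hex.exact_to_end Z g (hpull g hg)⟩, hrad⟩

theorem IsAuslanderReiten.ne_zero {A B : C} {X : NComplex n A B} {δ : Extn 𝔼 B A}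
    (hs : IsNExangulated hn 𝔼 s) (h : IsAuslanderReiten s X δ) : δ ≠ 0 := by
  rintro rfl
  obtain ⟨g, hg⟩ := (hs.exangle _ X h.realizes).exact_from_end A (𝟙 A) (map_zero _)
  exact h.left_almost_split.1 ⟨⟨g, hg⟩⟩

variable [Linear k C] [IsBilinearBifunctor 𝔼]

namespace IsNExangulated

/-- Exactness of `𝒞(Z, A) ⟶ 𝔼(B, A) ⟶ 𝔼(Yₙ, A)` for a conflation `Z ⟶ ⋯ ⟶ Yₙ ⟶ B`. -/
theorem exists_pushExt_eq (hs : IsNExangulated hn 𝔼 s) {A B Z : C} {ζ : Extn 𝔼 B Z}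
    {Y : NComplex n Z B} (hY : s.Realizes Y ζ) (δ : Extn 𝔼 B A)
    (hδ : pullExt 𝔼 Y.last δ = 0) : ∃ g : Z ⟶ A, pushExt 𝔼 g ζ = δ := by
  -- Bundling `ζ` and `δ` into one extension lets a good lift of `fst` compare them.
  set η : Extn 𝔼 B (Z ⊞ A) := pushExt 𝔼 biprod.inl ζ + pushExt 𝔼 biprod.inr δ with hη
  have hfst : pushExt 𝔼 biprod.fst η = ζ := by
    rw [hη, map_add, ← pushExt_comp_apply, ← pushExt_comp_apply, biprod.inl_fst, biprod.inr_fst,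
      pushExt_id_apply, pushExt_zero_apply, add_zero]
  have hsnd : pushExt 𝔼 biprod.snd η = δ := by
    rw [hη, map_add, ← pushExt_comp_apply, ← pushExt_comp_apply, biprod.inl_snd, biprod.inr_snd,
      pushExt_id_apply, pushExt_zero_apply, zero_add]
  have hlast : pullExt 𝔼 Y.last η = 0 := by
    rw [hη, map_add, ← pushExt_pullExt, ← pushExt_pullExt, hδ, (hs.exangle ζ Y hY).pull_last,
      map_zero, map_zero, add_zero]
  obtain ⟨W, hW⟩ := s.exists_realizes η
  obtain ⟨f, N, hends, ⟨e, he, -, -⟩, hN⟩ :=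
    hs.good_lift_op η biprod.fst W Y hW (by rw [hfst]; exact hY)
  -- The cocone now realizes the zero extension, so its first map is a section.
  rw [hlast] at hN
  obtain ⟨r, hr⟩ := (hs.exangle _ N hN).exact_from_end _ (𝟙 _) (map_zero _)
  have hf0 : W.left.inv ≫ f.f 0 = biprod.fst ≫ Y.left.inv := by
    rw [Iso.inv_comp_eq, ← Category.assoc, ← hends.1, Category.assoc, Iso.hom_inv_id,
      Category.comp_id]
  have hfirst : N.first = biprod.lift (biprod.fst ≫ Y.left.inv) W.first ≫ (e 1 le_rfl hn).inv := by
    rw [← hf0, Iso.eq_comp_inv]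
    exact he hn
  have hid : 𝟙 (Z ⊞ A) = biprod.fst ≫ Y.left.inv ≫ biprod.inl ≫ (e 1 le_rfl hn).inv ≫ r +
      W.first ≫ biprod.inr ≫ (e 1 le_rfl hn).inv ≫ r := by
    rw [← hr, hfirst, biprod.lift_eq]
    simp only [Preadditive.add_comp, Category.assoc]
  -- Pushing `η` along this decomposition of the identity kills the part through `W.first` and
  -- leaves `η` as a push of `ζ`; its `A`-component gives the claim.
  have h1 : pushExt 𝔼 (Y.left.inv ≫ biprod.inl ≫ (e 1 le_rfl hn).inv ≫ r) ζ = η := by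
    conv_rhs => rw [← pushExt_id_apply 𝔼 η, hid, IsBilinearBifunctor.push_add,
      pushExt_comp_apply, hfst, pushExt_comp_apply 𝔼 W.first, (hs.exangle η W hW).push_first,
      map_zero, add_zero]
  exact ⟨_, by rw [← hsnd, ← h1, ← pushExt_comp_apply]⟩

/-- Exactness of `𝒞(F, B) ⟶ 𝔼(F, A) ⟶ 𝔼(F, X₁)` for a conflation `A ⟶ X₁ ⟶ ⋯ ⟶ B`. -/
theorem exists_pullExt_eq (hs : IsNExangulated hn 𝔼 s) {A B F : C} {δ : Extn 𝔼 B A}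
    {X : NComplex n A B} (hX : s.Realizes X δ) (θ : Extn 𝔼 F A)
    (hθ : pushExt 𝔼 X.first θ = 0) : ∃ c : F ⟶ B, pullExt 𝔼 c δ = θ := by
  set η : Extn 𝔼 (B ⊞ F) A := pullExt 𝔼 biprod.fst δ + pullExt 𝔼 biprod.snd θ with hη
  have hinl : pullExt 𝔼 biprod.inl η = δ := by
    rw [hη, map_add, ← pullExt_comp_apply, ← pullExt_comp_apply, biprod.inl_fst, biprod.inl_snd,
      pullExt_id_apply, pullExt_zero_apply, add_zero]
  have hinr : pullExt 𝔼 biprod.inr η = θ := by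
    rw [hη, map_add, ← pullExt_comp_apply, ← pullExt_comp_apply, biprod.inr_fst, biprod.inr_snd,
      pullExt_id_apply, pullExt_zero_apply, zero_add]
  have hfirst : pushExt 𝔼 X.first η = 0 := by
    rw [hη, map_add, pushExt_pullExt, pushExt_pullExt, hθ, (hs.exangle δ X hX).push_first,
      map_zero, map_zero, add_zero]
  obtain ⟨W, hW⟩ := s.exists_realizes η
  obtain ⟨f, M, hends, ⟨e, -, -, he⟩, hM⟩ :=
    hs.good_lift η biprod.inl X W (by rw [hinl]; exact hX) hW
  -- Dually, the cone realizes zero, so its last map is a retraction and the identity of `B ⊞ F`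
  -- decomposes.
  rw [hfirst] at hM
  obtain ⟨r, hr⟩ := (hs.exangle _ M hM).exact_to_end _ (𝟙 _) (map_zero _)
  have hlast : M.last = (e n hn le_rfl).hom ≫ biprod.desc (X.right.hom ≫ biprod.inl) W.last := by
    rw [he hn, hends.2]
  have hid : 𝟙 (B ⊞ F) = (r ≫ (e n hn le_rfl).hom ≫ biprod.fst ≫ X.right.hom) ≫ biprod.inl +
      (r ≫ (e n hn le_rfl).hom ≫ biprod.snd) ≫ W.last := by
    rw [← hr, hlast, biprod.desc_eq]
    simp only [Preadditive.comp_add, Category.assoc]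
  have h1 : pullExt 𝔼 (r ≫ (e n hn le_rfl).hom ≫ biprod.fst ≫ X.right.hom) δ = η := by
    conv_rhs => rw [← pullExt_id_apply 𝔼 η, hid, IsBilinearBifunctor.pull_add,
      pullExt_comp_apply, hinl, pullExt_comp_apply 𝔼 _ W.last, (hs.exangle η W hW).pull_last,
      map_zero, add_zero]
  exact ⟨_, by rw [← hinr, ← h1, ← pullExt_comp_apply]⟩

/-- If `g_* δ ≠ 0`, the last map of its realization is a nonretraction and kills `δ`. By exactness
`δ` is a push of `g_* δ`, so `g` is a section. -/
theorem pushExt_eq_zero_of_pullExt (hs : IsNExangulated hn 𝔼 s) {A B : C} [IsLocalRing (End A)]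
    {δ : Extn 𝔼 B A} (hδ : δ ≠ 0)
    (hpull : ∀ ⦃Z : C⦄ (g : Z ⟶ B), ¬ IsSplitEpi g → pullExt 𝔼 g δ = 0)
    ⦃Z : C⦄ (g : A ⟶ Z) (hg : ¬ IsSplitMono g) : pushExt 𝔼 g δ = 0 := by
  by_contra hne
  obtain ⟨Y, hY⟩ := s.exists_realizes (pushExt 𝔼 g δ)
  obtain ⟨h, hh⟩ := hs.exists_pushExt_eq hY δ
    (hpull _ ((hs.exangle _ Y hY).not_isSplitEpi_last hne))
  exact hg (isSplitMono_of_pushExt_comp 𝔼 hδ g h hh)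

theorem pullExt_eq_zero_of_pushExt (hs : IsNExangulated hn 𝔼 s) {A B : C} [IsLocalRing (End B)]
    {δ : Extn 𝔼 B A} (hδ : δ ≠ 0)
    (hpush : ∀ ⦃Z : C⦄ (g : A ⟶ Z), ¬ IsSplitMono g → pushExt 𝔼 g δ = 0)
    ⦃Z : C⦄ (g : Z ⟶ B) (hg : ¬ IsSplitEpi g) : pullExt 𝔼 g δ = 0 := by
  by_contra hne
  obtain ⟨Y, hY⟩ := s.exists_realizes (pullExt 𝔼 g δ)
  obtain ⟨c, hc⟩ := hs.exists_pullExt_eq hY δ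
    (hpush _ ((hs.exangle _ Y hY).not_isSplitMono_first hne))
  exact hg (isSplitEpi_of_pullExt_comp 𝔼 hδ g c hc)

end IsNExangulated

namespace IsAuslanderReiten

variable {A B : C} {X : NComplex n A B} {δ : Extn 𝔼 B A}

/-- `Y.last` is not a retraction, so it factors through `X.last` and kills `δ`; exactness gives `g`.
-/
theorem exists_pushExt_eq (hs : IsNExangulated hn 𝔼 s) (h : IsAuslanderReiten s X δ) {Z : C}
    {ζ : Extn 𝔼 B Z} (hζ : ζ ≠ 0) : ∃ g : Z ⟶ A, pushExt 𝔼 g ζ = δ := by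
  obtain ⟨Y, hY⟩ := s.exists_realizes ζ
  obtain ⟨t, ht⟩ := h.right_almost_split.2 Y.last ((hs.exangle ζ Y hY).not_isSplitEpi_last hζ)
  refine hs.exists_pushExt_eq hY δ ?_
  rw [← ht, pullExt_comp_apply, (hs.exangle δ X h.realizes).pull_last, map_zero]

theorem exists_pullExt_eq (hs : IsNExangulated hn 𝔼 s) (h : IsAuslanderReiten s X δ) {F : C}
    {θ : Extn 𝔼 F A} (hθ : θ ≠ 0) : ∃ c : B ⟶ F, pullExt 𝔼 c θ = δ := by
  obtain ⟨Y, hY⟩ := s.exists_realizes θ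
  obtain ⟨t, ht⟩ := h.left_almost_split.2 Y.first ((hs.exangle θ Y hY).not_isSplitMono_first hθ)
  refine hs.exists_pullExt_eq hY δ ?_
  rw [← ht, pushExt_comp_apply, (hs.exangle δ X h.realizes).push_first, map_zero]

end IsAuslanderReiten

end Exactness

/-! ### Passing between `δ` and the dualities. -/

section Duality

variable {k : Type uk} [CommRing k] [IsArtinianRing k] {J : Type uk} [AddCommGroup J] [Module k J]
  {C : Type u} [Category.{v} C] [Preadditive C] [Linear k C]
  {𝔼 : Cᵒᵖ ⥤ C ⥤ ModuleCat.{w} k} [IsBilinearBifunctor 𝔼]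

theorem isFiniteLength_of_finite (M : Type*) [AddCommGroup M] [Module k M] [Module.Finite k M] :
    IsFiniteLength k M :=
  isFiniteLength_iff_isNoetherian_isArtinian.2 ⟨inferInstance, inferInstance⟩

/-- The isomorphism is induced by the pairing `(f, ε) ↦ γ (f^* ε)`. -/
theorem stableHomIsoDualExt_of_nondegenerate (hJ : IsMinimalInjectiveCogenerator k J)
    (hfin : ∀ A B : C, Module.Finite k (Extn 𝔼 A B)) {A B : C} {δ : Extn 𝔼 B A} (hδ : δ ≠ 0)
    (hpush : ∀ ⦃Z : C⦄ (ζ : Extn 𝔼 B Z), ζ ≠ 0 → ∃ g : Z ⟶ A, pushExt 𝔼 g ζ = δ)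
    (hpull : ∀ ⦃F : C⦄ (θ : Extn 𝔼 F A), θ ≠ 0 → ∃ c : B ⟶ F, pullExt 𝔼 c θ = δ) :
    StableHomIsoDualExt 𝔼 J B A := by
  obtain ⟨γ, hγ⟩ := hJ.exists_apply_ne_zero hδ
  let P : ∀ X : C, StableHom 𝔼 B X →ₗ[k] Extn 𝔼 X A →ₗ[k] J := fun X =>
    (projTrivial 𝔼 B X).liftQ ((pullBilin 𝔼 A X B).compr₂ γ) fun f hf => by
      ext ε
      change γ (pullExt 𝔼 f ε) = 0
      rw [hf A ε, map_zero]
  have hP : ∀ X, Function.Bijective (P X) := by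
    intro X
    refine (hJ.bijective_of_nondegenerate
      (@isFiniteLength_of_finite _ _ _ _ _ _ (hfin X A)) (P X) ?_ ?_).1
    · rw [← LinearMap.ker_eq_bot, LinearMap.ker_eq_bot']
      intro f hf
      obtain ⟨f, rfl⟩ := Submodule.Quotient.mk_surjective _ f
      rw [Submodule.Quotient.mk_eq_zero]
      intro Z ζ
      by_contra hne
      -- A nonzero `f^* ζ` with arbitrary coefficients `Z` is moved to `δ` by `g`, so `f` pairs
      -- nontrivially with `g_* ζ ∈ 𝔼(X, A)`.
      obtain ⟨g, hg⟩ := hpush _ hne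
      apply hγ
      rw [← hg, pushExt_pullExt]
      exact LinearMap.congr_fun hf (pushExt 𝔼 g ζ)
    · rw [← LinearMap.ker_eq_bot, LinearMap.ker_eq_bot']
      intro ε hε
      by_contra hne
      obtain ⟨c, hc⟩ := hpull ε hne
      apply hγ
      rw [← hc]
      exact LinearMap.congr_fun hε (Submodule.Quotient.mk c)
  refine ⟨fun X => LinearEquiv.ofBijective (P X) (hP X), fun X Y g b => ?_⟩
  obtain ⟨f, rfl⟩ := Submodule.Quotient.mk_surjective _ b
  ext ε
  exact congrArg γ (pullExt_comp_apply 𝔼 f g ε)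

/-- Here the pairing is `(f, ζ) ↦ γ (f_* ζ)`, and its flip gives the isomorphism. -/
theorem extIsoDualCostableHom_of_nondegenerate (hJ : IsMinimalInjectiveCogenerator k J)
    (hfin : ∀ A B : C, Module.Finite k (Extn 𝔼 A B)) {A B : C} {δ : Extn 𝔼 B A} (hδ : δ ≠ 0)
    (hpush : ∀ ⦃Z : C⦄ (ζ : Extn 𝔼 B Z), ζ ≠ 0 → ∃ g : Z ⟶ A, pushExt 𝔼 g ζ = δ)
    (hpull : ∀ ⦃F : C⦄ (θ : Extn 𝔼 F A), θ ≠ 0 → ∃ c : B ⟶ F, pullExt 𝔼 c θ = δ) :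
    ExtIsoDualCostableHom 𝔼 J B A := by
  obtain ⟨γ, hγ⟩ := hJ.exists_apply_ne_zero hδ
  let P : ∀ X : C, CostableHom 𝔼 X A →ₗ[k] Extn 𝔼 B X →ₗ[k] J := fun X =>
    (injTrivial 𝔼 X A).liftQ ((pushBilin 𝔼 X A B).compr₂ γ) fun f hf => by
      ext ζ
      change γ (pushExt 𝔼 f ζ) = 0
      rw [hf B ζ, map_zero]
  have hP : ∀ X, Function.Bijective (P X).flip := by
    intro X
    refine (hJ.bijective_of_nondegenerate
      (@isFiniteLength_of_finite _ _ _ _ _ _ (hfin B X)) (P X) ?_ ?_).2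
    · rw [← LinearMap.ker_eq_bot, LinearMap.ker_eq_bot']
      intro f hf
      obtain ⟨f, rfl⟩ := Submodule.Quotient.mk_surjective _ f
      rw [Submodule.Quotient.mk_eq_zero]
      intro F θ
      by_contra hne
      obtain ⟨c, hc⟩ := hpull _ hne
      apply hγ
      rw [← hc, ← pushExt_pullExt]
      exact LinearMap.congr_fun hf (pullExt 𝔼 c θ)
    · rw [← LinearMap.ker_eq_bot, LinearMap.ker_eq_bot']
      intro ζ hζ
      by_contra hne
      obtain ⟨g, hg⟩ := hpush ζ hne
      apply hγ
      rw [← hg]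
      exact LinearMap.congr_fun hζ (Submodule.Quotient.mk g)
  refine ⟨fun X => LinearEquiv.ofBijective (P X).flip (hP X), fun X Y g ζ => ?_⟩
  apply LinearMap.ext
  intro b
  obtain ⟨f, rfl⟩ := Submodule.Quotient.mk_surjective _ b
  exact congrArg γ (pushExt_comp_apply 𝔼 g f ζ).symm

/-- Under `𝒞(B, -)/𝒫 ≅ D 𝔼(-, A)` there is a nonzero extension killed by all nonretractions. -/
theorem StableHomIsoDualExt.exists_socle {A B : C} (h : StableHomIsoDualExt 𝔼 J B A)
    (hJ : IsInjectiveCogenerator k J) (hfin : Module.Finite k (Extn 𝔼 B A))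
    [IsLocalRing (End B)] (hB : ¬ IsProjectiveObj 𝔼 B) :
    ∃ δ : Extn 𝔼 B A, δ ≠ 0 ∧ ∀ ⦃Z : C⦄ (g : Z ⟶ B), ¬ IsSplitEpi g → pullExt 𝔼 g δ = 0 := by
  obtain ⟨φ, hφ⟩ := h
  have hnt : Nontrivial (Extn 𝔼 B A) := by
    by_contra hsub
    rw [not_nontrivial_iff_subsingleton] at hsub
    apply hB
    have h0 : (Submodule.Quotient.mk (𝟙 B) : StableHom 𝔼 B B) = 0 :=
      (φ B).injective (Subsingleton.elim _ _)
    exact (Submodule.Quotient.mk_eq_zero _).1 h0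
  obtain ⟨δ, hδ, hmin⟩ := IsArtinian.exists_minimal_orbit (pullBilin 𝔼 A B B)
    ⟨𝟙 B, pullExt_id_apply 𝔼⟩ fun a b => ⟨a ≫ b, pullExt_comp_apply 𝔼 a b⟩
  refine ⟨δ, hδ, fun Z g hg => ?_⟩
  by_contra hne
  obtain ⟨l, hl⟩ := hJ.exists_apply_ne_zero hne
  obtain ⟨b, rfl⟩ := (φ Z).surjective l
  obtain ⟨f, rfl⟩ := Submodule.Quotient.mk_surjective _ b
  -- By naturality the functional attached to `f` is that of `𝟙 B` composed with `f^*`, so it would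
  -- vanish on `g^* δ` if `(f ≫ g)^* δ` were zero.
  have hfg : pullExt 𝔼 (f ≫ g) δ ≠ 0 := by
    intro h0
    apply hl
    have h1 := LinearMap.congr_fun (hφ B Z f (Submodule.Quotient.mk (𝟙 B)))
      (pullExt 𝔼 g δ)
    have h2 : stablePost 𝔼 B f (Submodule.Quotient.mk (𝟙 B)) = Submodule.Quotient.mk f :=
      congrArg Submodule.Quotient.mk (Category.id_comp f)
    rw [h2, LinearMap.comp_apply, ← pullExt_comp_apply, h0, map_zero] at h1
    exact h1
  obtain ⟨c, hc⟩ := hmin (f ≫ g) hfg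
  refine hg (isSplitEpi_of_pullExt_comp 𝔼 hδ g (c ≫ f) ?_)
  rw [← pullExt_comp_apply, Category.assoc, pullExt_comp_apply]
  exact hc

/-- Under `𝔼(B, -) ≅ D 𝒞(-, A)/ℐ` there is a nonzero extension killed by all nonsections. -/
theorem ExtIsoDualCostableHom.exists_socle {A B : C} (h : ExtIsoDualCostableHom 𝔼 J B A)
    (hJ : IsInjectiveCogenerator k J) (hfin : Module.Finite k (Extn 𝔼 B A))
    [IsLocalRing (End A)] (hA : ¬ IsInjectiveObj 𝔼 A) :
    ∃ δ : Extn 𝔼 B A, δ ≠ 0 ∧ ∀ ⦃Z : C⦄ (g : A ⟶ Z), ¬ IsSplitMono g → pushExt 𝔼 g δ = 0 := by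
  obtain ⟨φ, hφ⟩ := h
  have hnt : Nontrivial (Extn 𝔼 B A) := by
    have h1 : (Submodule.Quotient.mk (𝟙 A) : CostableHom 𝔼 A A) ≠ 0 := fun h0 =>
      hA ((Submodule.Quotient.mk_eq_zero _).1 h0)
    obtain ⟨l, hl⟩ := hJ.exists_apply_ne_zero h1
    refine ⟨(φ A).symm l, 0, fun h0 => hl ?_⟩
    rw [(φ A).symm.map_eq_zero_iff.1 h0, LinearMap.zero_apply]
  obtain ⟨δ, hδ, hmin⟩ := IsArtinian.exists_minimal_orbit (pushBilin 𝔼 A A B)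
    ⟨𝟙 A, pushExt_id_apply 𝔼⟩ fun a b => ⟨b ≫ a, pushExt_comp_apply 𝔼 b a⟩
  refine ⟨δ, hδ, fun Z g hg => ?_⟩
  by_contra hne
  obtain ⟨b, hb⟩ : ∃ b, φ Z (pushExt 𝔼 g δ) b ≠ 0 := by
    by_contra! hall
    exact hne ((φ Z).map_eq_zero_iff.1 (LinearMap.ext hall))
  obtain ⟨f, rfl⟩ := Submodule.Quotient.mk_surjective _ b
  -- By naturality, evaluating the functional of `g_* δ` at `f` is evaluating that of `(g ≫ f)_* δ`
  -- at `𝟙 A`.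
  have hgf : pushExt 𝔼 (g ≫ f) δ ≠ 0 := by
    intro h0
    apply hb
    have h1 := LinearMap.congr_fun (hφ Z A f (pushExt 𝔼 g δ)) (Submodule.Quotient.mk (𝟙 A))
    have h2 : costablePre 𝔼 f A (Submodule.Quotient.mk (𝟙 A)) = Submodule.Quotient.mk f :=
      congrArg Submodule.Quotient.mk (Category.comp_id f)
    rw [LinearMap.comp_apply, h2, ← pushExt_comp_apply, h0, map_zero] at h1
    exact h1.symm
  obtain ⟨c, hc⟩ := hmin (g ≫ f) hgf
  refine hg (isSplitMono_of_pushExt_comp 𝔼 hδ g (f ≫ c) ?_)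
  rw [← pushExt_comp_apply, ← Category.assoc, pushExt_comp_apply]
  exact hc

end Duality

end

theorem lemma3p7 {k : Type uk} [CommRing k] [IsArtinianRing k]
    (J : Type uk) [AddCommGroup J] [Module k J] (hJ : IsMinimalInjectiveCogenerator k J)
    {C : Type u} [Category.{v} C] [Preadditive C] [Linear k C] [HasFiniteBiproducts C]
    (hKS : IsKrullSchmidt C)
    (𝔼 : Cᵒᵖ ⥤ C ⥤ ModuleCat.{w} k) [IsBilinearBifunctor 𝔼]
    (hfin : ∀ A B : C, Module.Finite k (Extn 𝔼 A B))
    {n : ℕ} (hn : 1 ≤ n) (s : ExtnRealization 𝔼 n) (hs : IsNExangulated hn 𝔼 s)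
    (X₀ Xₙ₁ : C) (hX₀ : Indecomposable X₀) (hX₀' : ¬ IsInjectiveObj 𝔼 X₀)
    (hXₙ₁ : Indecomposable Xₙ₁) (hXₙ₁' : ¬ IsProjectiveObj 𝔼 Xₙ₁) :
    List.TFAE [
      ∃ (δ : Extn 𝔼 Xₙ₁ X₀) (X : NComplex n X₀ Xₙ₁), IsAuslanderReiten s X δ,
      StableHomIsoDualExt 𝔼 J Xₙ₁ X₀,
      ExtIsoDualCostableHom 𝔼 J Xₙ₁ X₀] := by
  have := hKS.isLocalRing_end hX₀
  have := hKS.isLocalRing_end hXₙ₁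
  tfae_have 1 → 2 := fun ⟨δ, X, h⟩ => stableHomIsoDualExt_of_nondegenerate hJ hfin (h.ne_zero hs)
    (fun _ _ hζ => h.exists_pushExt_eq hs hζ) (fun _ _ hθ => h.exists_pullExt_eq hs hθ)
  tfae_have 1 → 3 := fun ⟨δ, X, h⟩ => extIsoDualCostableHom_of_nondegenerate hJ hfin
    (h.ne_zero hs) (fun _ _ hζ => h.exists_pushExt_eq hs hζ)
    (fun _ _ hθ => h.exists_pullExt_eq hs hθ)
  tfae_have 2 → 1 := fun h => by
    obtain ⟨δ, hδ, hpull⟩ := h.exists_socle hJ.toIsInjectiveCogenerator (hfin _ _) hXₙ₁'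
    exact ⟨δ, hs.exists_isAuslanderReiten hKS hδ (hs.pushExt_eq_zero_of_pullExt hδ hpull) hpull⟩
  tfae_have 3 → 1 := fun h => by
    obtain ⟨δ, hδ, hpush⟩ := h.exists_socle hJ.toIsInjectiveCogenerator (hfin _ _) hX₀'
    exact ⟨δ, hs.exists_isAuslanderReiten hKS hδ hpush (hs.pullExt_eq_zero_of_pushExt hδ hpush)⟩
  tfae_finish
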